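/- **Theorem (Fundamental Identity).** Let $N\ge 2$ and let $\Omega\subset\mathbb{R}^N$ be a (nonempty) open, connected, bounded set with $C^2$ boundary. Let $\nu$ be the outer unit normal on $\partial\Omega$. Let $\nabla\nu$ denote the linear map whose value on a vector tangent to $\partial\Omega$ is the derivative of $\nu$ along $\partial\Omega$ in that direction, and for which $(\nabla\nu)\nu=0$. Let $\kappa_1,\dots,\kappa_{N-1}$ be the principal curvatures of $\partial\Omega$, i.e. the eigenvalues of $\nabla\nu$ on the tangent space (nonnegative for convex $\Omega$), and let $\mathcal M=\frac1{N-1}\sum_{i=1}^{N-1}\kappa_i$ be the mean curvature. For a function $f$ put $\partial_\nu f=\langle\nabla f,\nu\rangle$ and $\nabla^\tau f=\nabla f-\langle\nabla f,\nu\rangle\,\nu$ on $\partial\Omega$. Let $\beta\in\mathbb{R}\setminus\{0\}$ be such that $\beta\ne-\mu$ for every Steklov eigenvalue $\mu$ of $\Omega$, that is, for every $\mu\in\mathbb{R}$ for which there is a function $v\not\equiv0$ with $\Delta v=0$ in $\Omega$ and $\partial_\nu v=\mu v$ on $\partial\Omega$ (with $v\in C^2(\Omega)\cap C^1(\overline\Omega)$).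 Let $u\in C^2(\overline\Omega)$ be a solution of the Robin torsion problem $$\Delta u=N\ \text{ in }\Omega,\qquad \partial_\nu u+\beta u=0\ \text{ on }\partial\Omega,$$ and let $P=\tfrac12|\nabla u|^2-u$ on $\overline\Omega$. Then $P\in C^2(\Omega)$, all the integrands below are integrable, and $$\int_\Omega\Delta P\,dx=-\int_{\partial\Omega}\langle(\nabla\nu)\nabla^\tau u,\nabla^\tau u\rangle\,d\mathcal H^{N-1}-2\beta\int_{\partial\Omega}|\nabla^\tau u|^2\,d\mathcal H^{N-1}-(N-1)\int_{\partial\Omega}\langle\nabla u,\nu\rangle\bigl(\langle\nabla u,\nu\rangle\,\mathcal M-1\bigr)\,d\mathcal H^{N-1}.$$ -/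

import Mathlib

open MeasureTheory Set Filter Topology InnerProductSpace
open scoped Laplacian

noncomputable section

namespace RobinTorsion

variable {N : ℕ}

/-! ### Domains with `C²` boundary and the geometry of the boundary -/

/-- `φ` is a `C²` defining function of `Ω` near the boundary point `p`: it is `C²` near `p`, has
nonzero gradient at `p`, and near `p` the set `Ω` is the sublevel set `{φ < 0}`. -/
structure IsLocalDefiningFunction (Ω : Set (EuclideanSpace ℝ (Fin N)))
    (p : EuclideanSpace ℝ (Fin N)) (φ : EuclideanSpace ℝ (Fin N) → ℝ) : Prop where
  contDiffAt : ContDiffAt ℝ 2 φ p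
  gradient_ne_zero : gradient φ p ≠ 0
  eventually_mem_iff : ∀ᶠ x in 𝓝 p, x ∈ Ω ↔ φ x < 0

/-- `Ω` has `C²` boundary: near each boundary point, `Ω` lies on one side of a `C²` hypersurface. -/
def HasC2Boundary (Ω : Set (EuclideanSpace ℝ (Fin N))) : Prop :=
  ∀ p ∈ frontier Ω, ∃ φ, IsLocalDefiningFunction Ω p φ

/-- `n` is the outer unit normal of `Ω` at `p`: `n = ∇φ(p) / |∇φ(p)|` for a local defining
function `φ`. -/
def IsOuterUnitNormal (Ω : Set (EuclideanSpace ℝ (Fin N)))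
    (p n : EuclideanSpace ℝ (Fin N)) : Prop :=
  ∃ φ, IsLocalDefiningFunction Ω p φ ∧ n = ‖gradient φ p‖⁻¹ • gradient φ p

/-- A defining function vanishes at the boundary point. -/
theorem IsLocalDefiningFunction.eq_zero {Ω : Set (EuclideanSpace ℝ (Fin N))}
    {p : EuclideanSpace ℝ (Fin N)} {φ : EuclideanSpace ℝ (Fin N) → ℝ}
    (h : IsLocalDefiningFunction Ω p φ) (hp : p ∈ frontier Ω) (ho : IsOpen Ω) : φ p = 0 := by
  have hc := h.contDiffAt.continuousAt
  apply le_antisymm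
  · by_contra! hlt
    have h1 := hc.eventually (lt_mem_nhds hlt)
    have h2 : ∃ᶠ x in 𝓝 p, x ∈ Ω := mem_closure_iff_frequently.1 hp.1
    obtain ⟨x, hx, h3, h4⟩ := (h2.and_eventually (h1.and h.eventually_mem_iff)).exists
    exact absurd (h4.1 hx) (not_lt.2 (le_of_lt h3))
  · by_contra! hlt
    have := h.eventually_mem_iff.self_of_nhds.2 hlt
    rw [ho.frontier_eq] at hp
    exact hp.2 this

/-- The outer unit normal at a boundary point does not depend on the defining function. -/
theorem isOuterUnitNormal_unique {Ω : Set (EuclideanSpace ℝ (Fin N))}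
    {p n m : EuclideanSpace ℝ (Fin N)} (ho : IsOpen Ω) (hp : p ∈ frontier Ω)
    (hn : IsOuterUnitNormal Ω p n) (hm : IsOuterUnitNormal Ω p m) : n = m := by
  obtain ⟨φ, hφ, rfl⟩ := hn
  obtain ⟨ψ, hψ, rfl⟩ := hm
  have key : ∀ (φ : EuclideanSpace ℝ (Fin N) → ℝ) (_ : IsLocalDefiningFunction Ω p φ)
      (v : EuclideanSpace ℝ (Fin N)),
      HasDerivAt (fun t : ℝ => φ (p + t • v)) (inner ℝ (gradient φ p) v) 0 := by
    intro φ hφ v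
    have h1 : HasGradientAt φ (gradient φ p) p :=
      (hφ.contDiffAt.differentiableAt (by norm_num)).hasGradientAt
    have h2 : HasDerivAt (fun t : ℝ => p + t • v) v 0 := by
      simpa using ((hasDerivAt_id (0:ℝ)).smul_const v).const_add p
    have h3 : HasFDerivAt φ ((InnerProductSpace.toDual ℝ _) (gradient φ p)) (p + (0:ℝ) • v) := by
      simpa using h1.hasFDerivAt
    have h4 := h3.comp_hasDerivAt (0:ℝ) h2
    rwa [InnerProductSpace.toDual_apply_apply] at h4
  have main : ∀ v, inner ℝ (gradient φ p) v < 0 → ¬ 0 < inner ℝ (gradient ψ p) v := by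
    intro v h1 h2
    have a := (hasDerivAt_iff_tendsto_slope.1 (key φ hφ v)).eventually (gt_mem_nhds h1)
    have b := (hasDerivAt_iff_tendsto_slope.1 (key ψ hψ v)).eventually (lt_mem_nhds h2)
    have c : Tendsto (fun t : ℝ => p + t • v) (𝓝[>] 0) (𝓝 p) := by
      have : Continuous (fun t : ℝ => p + t • v) := by fun_prop
      have := this.tendsto 0
      simp only [zero_smul, add_zero] at this
      exact this.mono_left nhdsWithin_le_nhds
    have le : 𝓝[>] (0:ℝ) ≤ 𝓝[≠] 0 := nhdsWithin_mono _ (fun x hx => ne_of_gt hx)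
    obtain ⟨t, h1, h2, h3, h4, h5⟩ := ((a.filter_mono le).and ((b.filter_mono le).and
      ((c.eventually hφ.eventually_mem_iff).and ((c.eventually hψ.eventually_mem_iff).and
        self_mem_nhdsWithin)))).exists
    have h5 : 0 < t := h5
    simp only [slope_def_field, zero_smul, add_zero, hφ.eq_zero hp ho, hψ.eq_zero hp ho, sub_zero] at h1 h2
    have e1 : φ (p + t • v) < 0 := by
      rcases div_neg_iff.1 h1 with h | h <;> linarith [h.1, h.2]
    have e2 : 0 < ψ (p + t • v) := by
      rcases div_pos_iff.1 h2 with h | h <;> linarith [h.1, h.2]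
    exact absurd (h4.1 (h3.2 e1)) (not_lt.2 e2.le)
  set a := gradient φ p
  set b := gradient ψ p
  have ha : 0 < ‖a‖ := norm_pos_iff.2 hφ.gradient_ne_zero
  have hb : 0 < ‖b‖ := norm_pos_iff.2 hψ.gradient_ne_zero
  by_contra hne
  have hlt : inner ℝ (‖a‖⁻¹ • a) (‖b‖⁻¹ • b) < 1 := by
    refine (inner_lt_one_iff_real_of_norm_eq_one ?_ ?_).2 hne
    · simp [norm_smul, ha.ne']
    · simp [norm_smul, hb.ne']
  simp only [real_inner_smul_left, real_inner_smul_right] at hlt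
  have hlt' : inner ℝ a b < ‖a‖ * ‖b‖ := by
    rw [inv_mul_eq_div, inv_mul_eq_div, div_div, div_lt_one (by positivity)] at hlt
    linarith
  refine main (‖a‖ • b - ‖b‖ • a) ?_ ?_
  · rw [inner_sub_right, real_inner_smul_right, real_inner_smul_right, real_inner_self_eq_norm_sq]
    nlinarith
  · rw [inner_sub_right, real_inner_smul_right, real_inner_smul_right, real_inner_self_eq_norm_sq, real_inner_comm]
    nlinarith

open Classical in
/-- The outer unit normal field `ν` on `∂Ω` (extended by `0` where there is none). -/
def outerNormal (Ω : Set (EuclideanSpace ℝ (Fin N))) (p : EuclideanSpace ℝ (Fin N)) :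
    EuclideanSpace ℝ (Fin N) :=
  if h : p ∈ frontier Ω ∧ ∃ n, IsOuterUnitNormal Ω p n then h.2.choose else 0

/-- The tangent space `T_p ∂Ω = ν(p)^⊥`. -/
def tangentPlane (Ω : Set (EuclideanSpace ℝ (Fin N))) (p : EuclideanSpace ℝ (Fin N)) :
    Submodule ℝ (EuclideanSpace ℝ (Fin N)) :=
  (ℝ ∙ outerNormal Ω p)ᗮ

/-- The matrix `∇ν` at `p ∈ ∂Ω`: on tangent vectors it is the derivative of `ν` along `∂Ω`, and
`(∇ν) ν = 0`. The derivative within `∂Ω` is determined by `ν` only on tangent vectors, whence the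
projection. -/
def gradNormal (Ω : Set (EuclideanSpace ℝ (Fin N))) (p : EuclideanSpace ℝ (Fin N)) :
    EuclideanSpace ℝ (Fin N) →L[ℝ] EuclideanSpace ℝ (Fin N) :=
  (fderivWithin ℝ (outerNormal Ω) (frontier Ω) p) ∘L (tangentPlane Ω p).starProjection

/-- The Weingarten map (shape operator) `T_p ∂Ω → T_p ∂Ω`, `τ ↦ (∇ν) τ`. It is positive
semidefinite when `Ω` is convex. -/
def weingarten (Ω : Set (EuclideanSpace ℝ (Fin N))) (p : EuclideanSpace ℝ (Fin N)) :
    tangentPlane Ω p →ₗ[ℝ] tangentPlane Ω p :=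
  ((tangentPlane Ω p).orthogonalProjectionOnto ∘L gradNormal Ω p ∘L
    (tangentPlane Ω p).subtypeL).toLinearMap

/-- The principal curvatures `κ₁, …, κ_{N-1}` of `∂Ω` at `p`: the eigenvalues of the Weingarten
map, with multiplicity. -/
def principalCurvatures (Ω : Set (EuclideanSpace ℝ (Fin N))) (p : EuclideanSpace ℝ (Fin N)) :
    Multiset ℝ :=
  (weingarten Ω p).charpoly.roots

/-- The mean curvature `𝓜 = (κ₁ + ⋯ + κ_{N-1}) / (N - 1)`. -/
def meanCurvature (Ω : Set (EuclideanSpace ℝ (Fin N))) (p : EuclideanSpace ℝ (Fin N)) : ℝ :=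
  1 / ((N : ℝ) - 1) * (principalCurvatures Ω p).sum

/-- The surface measure on `∂Ω`: the (Euclidean-normalized) Hausdorff measure of dimension `N - 1`
restricted to `∂Ω`. -/
def surfaceMeasure (Ω : Set (EuclideanSpace ℝ (Fin N))) : Measure (EuclideanSpace ℝ (Fin N)) :=
  (μHE[N - 1] : Measure (EuclideanSpace ℝ (Fin N))).restrict (frontier Ω)

/-! ### Functions on the closed domain -/

/-- The gradient of a function on `Ω̄`, at points of `Ω̄` (the usual gradient at points of `Ω`). -/
def grad (Ω : Set (EuclideanSpace ℝ (Fin N))) (f : EuclideanSpace ℝ (Fin N) → ℝ)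
    (x : EuclideanSpace ℝ (Fin N)) : EuclideanSpace ℝ (Fin N) :=
  gradientWithin f (closure Ω) x

/-- The normal derivative `∂f/∂ν = ⟨∇f, ν⟩` on `∂Ω`. -/
def normalDeriv (Ω : Set (EuclideanSpace ℝ (Fin N))) (f : EuclideanSpace ℝ (Fin N) → ℝ)
    (x : EuclideanSpace ℝ (Fin N)) : ℝ :=
  inner ℝ (grad Ω f x) (outerNormal Ω x)

/-- The tangential gradient `∇^τ f = ∇f - ⟨∇f, ν⟩ ν` on `∂Ω`. -/
def tangentialGrad (Ω : Set (EuclideanSpace ℝ (Fin N))) (f : EuclideanSpace ℝ (Fin N) → ℝ)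
    (x : EuclideanSpace ℝ (Fin N)) : EuclideanSpace ℝ (Fin N) :=
  grad Ω f x - normalDeriv Ω f x • outerNormal Ω x

/-- `μ` is a Steklov eigenvalue of the Laplacian on `Ω`: there is `v ≠ 0`, in
`C²(Ω) ∩ C¹(Ω̄)`, with `Δv = 0` in `Ω` and `∂v/∂ν = μ v` on `∂Ω`. -/
def IsSteklovEigenvalue (Ω : Set (EuclideanSpace ℝ (Fin N))) (μ : ℝ) : Prop :=
  ∃ v : EuclideanSpace ℝ (Fin N) → ℝ,
    ContDiffOn ℝ 2 v Ω ∧ ContDiffOn ℝ 1 v (closure Ω) ∧ (∃ x ∈ closure Ω, v x ≠ 0) ∧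
    (∀ x ∈ Ω, (Δ v) x = 0) ∧ ∀ x ∈ frontier Ω, normalDeriv Ω v x = μ * v x

/-- `u ∈ C²(Ω̄)` solves the Robin torsion problem `Δu = N` in `Ω`, `∂u/∂ν + βu = 0` on `∂Ω`. -/
structure IsRobinTorsionSolution (Ω : Set (EuclideanSpace ℝ (Fin N))) (β : ℝ)
    (u : EuclideanSpace ℝ (Fin N) → ℝ) : Prop where
  contDiffOn : ContDiffOn ℝ 2 u (closure Ω)
  laplacian_eq : ∀ x ∈ Ω, (Δ u) x = (N : ℝ)
  robin : ∀ x ∈ frontier Ω, normalDeriv Ω u x + β * u x = 0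

/-- The function `P = ½|∇u|² - u` on `Ω̄`. -/
def pFunction (Ω : Set (EuclideanSpace ℝ (Fin N))) (u : EuclideanSpace ℝ (Fin N) → ℝ)
    (x : EuclideanSpace ℝ (Fin N)) : ℝ :=
  1 / 2 * ‖grad Ω u x‖ ^ 2 - u x

end RobinTorsion

end

noncomputable section

/-! ### Area formula for expanding maps of class C¹. -/

section AreaFormula

open Measure Module
open scoped NNReal ENNReal

/-! Write `H = D²u`, `V = ∇P = H∇u - ∇u`, `τ = ∇^τ u`, `d = ∂_ν u`, `κ = tr ∇ν = (N-1)𝓜`. Third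
derivatives of `u` enter `div V` only through `∇(Δu) = 0`, so `ΔP = tr(H²) - N` is continuous up to
the boundary although `u` is merely C² there. The divergence theorem for fields that are C¹ inside,
continuous on the closure and of integrable divergence (`HasGraphCharts.setIntegral_divergence`)
turns `∫ ΔP` into the boundary integral of `⟨V, ν⟩ = ⟨Hτ, ν⟩ + d⟨Hν, ν⟩ - d`.

Differentiating the Robin condition along `τ` gives `⟨Hτ, ν⟩ = -⟨(∇ν)τ, τ⟩ - β|τ|²`. The normal
second derivative is removed by the surface divergence theorem
(`HasGraphCharts.setIntegral_surfaceDivergence`) applied to `w = u∇u`: the integral of `u(N - ⟨Hν,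
ν⟩) + |τ|² - κud` over the boundary is zero. Multiplied by `β` and combined with `βu = -d`, this
supplies the second `-β|τ|²` and the curvature term. The pointwise algebra is `surface_identity`.

Both integral theorems rest on one device. A compactly supported C¹ field on the whole space has
divergence of integral zero. On a subgraph `{ρ < 0}` the field is multiplied by a cutoff in `-ρ/s`
that vanishes near and above the graph, so that differentiability is needed only inside. As `s → 0`,
integrals over the layers below the graph converge to an integral over the hyperplane
(`IsGraphFunction.tendsto_integral_layer`), which the area formula `map_withDensity_normDet`
identifies with a Hausdorff integral. The implicit function theorem and a partition of unity
globalize this.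

For `ΔP` to make sense classically, `u` must be C³ inside. This follows from
`contDiffAt_infty_of_laplacian_eq_const`: up to constants, `u` is locally its own convolution with a
smooth radial kernel. -/

theorem hausdorffMeasure_image_le_of_dist_le {α X Y : Type*} [MetricSpace X] [MeasurableSpace X]
    [BorelSpace X] [MetricSpace Y] [MeasurableSpace Y] [BorelSpace Y] {A : α → Y} {B : α → X}
    {s : Set α} {K : ℝ≥0} {d : ℝ} (hd : 0 ≤ d) (hB : InjOn B s)
    (h : ∀ x ∈ s, ∀ y ∈ s, dist (A x) (A y) ≤ K * dist (B x) (B y)) :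
    μH[d] (A '' s) ≤ (K : ℝ≥0∞) ^ d * μH[d] (B '' s) := by
  rcases s.eq_empty_or_nonempty with rfl | ⟨x₀, -⟩
  · simp
  have : Nonempty α := ⟨x₀⟩
  -- The correspondence `B x ↦ A x` is well defined because `B` is injective on `s`, and the
  -- distance bound makes it `K`-Lipschitz.
  have hT : LipschitzOnWith K (fun z => A (Function.invFunOn B s z)) (B '' s) := by
    apply LipschitzOnWith.of_dist_le_mul
    rintro _ ⟨x, hx, rfl⟩ _ ⟨y, hy, rfl⟩
    rw [hB.leftInvOn_invFunOn hx, hB.leftInvOn_invFunOn hy]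
    exact h x hx y hy
  have himg : (fun z => A (Function.invFunOn B s z)) '' (B '' s) = A '' s := by
    rw [image_image]
    exact image_congr fun x hx => by rw [hB.leftInvOn_invFunOn hx]
  rw [← himg]
  exact hT.hausdorffMeasure_image_le hd

theorem injective_of_expanding {F E : Type*} [NormedAddCommGroup F] [NormedAddCommGroup E]
    {G : F → E} (hG : ∀ a b, ‖a - b‖ ≤ ‖G a - G b‖) : Function.Injective G := by
  intro a b hab
  have := hG a b
  rw [hab, sub_self, norm_zero] at this
  exact sub_eq_zero.1 (norm_le_zero_iff.1 this)

theorem norm_le_norm_fderiv_of_expanding {F E : Type*} [NormedAddCommGroup F] [NormedSpace ℝ F]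
    [NormedAddCommGroup E] [NormedSpace ℝ E] {G : F → E} (hG : ∀ a b, ‖a - b‖ ≤ ‖G a - G b‖) {x : F}
    (hd : DifferentiableAt ℝ G x) (v : F) : ‖v‖ ≤ ‖fderiv ℝ G x v‖ := by
  have h := (hd.hasFDerivAt.hasLineDerivAt v).tendsto_slope_zero.norm
  refine ge_of_tendsto h ?_
  filter_upwards [self_mem_nhdsWithin] with t ht
  have ht : t ≠ 0 := ht
  have := hG (x + t • v) x
  rw [add_sub_cancel_left, norm_smul] at this
  rw [norm_smul, norm_inv, le_inv_mul_iff₀ (norm_pos_iff.2 ht)]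
  exact this

variable {F E : Type*} [NormedAddCommGroup F] [InnerProductSpace ℝ F] [FiniteDimensional ℝ F]
  [MeasurableSpace F] [BorelSpace F] [NormedAddCommGroup E] [InnerProductSpace ℝ E]
  [FiniteDimensional ℝ E] [MeasurableSpace E] [BorelSpace E]

theorem euclideanHausdorffMeasure_image_le_of_dist_le {α X Y : Type*} [MetricSpace X]
    [MeasurableSpace X]
    [BorelSpace X] [MetricSpace Y] [MeasurableSpace Y] [BorelSpace Y] {A : α → Y} {B : α → X}
    {s : Set α} {K : ℝ≥0} {d : ℕ} (hB : InjOn B s)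
    (h : ∀ x ∈ s, ∀ y ∈ s, dist (A x) (A y) ≤ K * dist (B x) (B y)) :
    μHE[d] (A '' s) ≤ (K : ℝ≥0∞) ^ d * μHE[d] (B '' s) := by
  have := hausdorffMeasure_image_le_of_dist_le (d := d) (by positivity) hB h
  rw [ENNReal.rpow_natCast] at this
  simp only [euclideanHausdorffMeasure_def, Measure.smul_apply, ENNReal.smul_def, smul_eq_mul]
  rw [mul_left_comm]
  gcongr

variable {G : F → E} {L : F →L[ℝ] E} {s : Set F} {ε : ℝ≥0}

/-- Since `L` does not shrink lengths, the error `ε‖x - y‖` is at most `ε‖L (x - y)‖`. The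
approximation thus becomes a ratio `1 + ε` between distances in the two images. -/
theorem ApproximatesLinearOn.euclideanHausdorffMeasure_image_le
    (h : ApproximatesLinearOn G L s ε) (hL : ∀ v, ‖v‖ ≤ ‖L v‖) :
    μHE[finrank ℝ F] (G '' s) ≤
      (1 + ε : ℝ≥0) ^ finrank ℝ F * (ENNReal.ofReal L.normDet * volume s) := by
  have hinj : Function.Injective L := by
    rw [injective_iff_map_eq_zero]
    intro v hv
    simpa [hv] using hL v
  rw [← InnerProductSpace.euclideanHausdorffMeasure_eq_volume,
    ← LinearMap.euclideanHausdorffMeasure_image]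
  refine euclideanHausdorffMeasure_image_le_of_dist_le (hinj.injOn) fun x hx y hy => ?_
  have h1 := h x hx y hy
  have h2 := hL (x - y)
  have h3 := norm_le_norm_add_norm_sub' (G x - G y) (L (x - y))
  have h4 := mul_le_mul_of_nonneg_left h2 ε.coe_nonneg
  simp only [dist_eq_norm, ContinuousLinearMap.coe_coe, ← map_sub, NNReal.coe_add, NNReal.coe_one]
  linarith

/-- The mirror image of the previous bound: here the expansion of `G` absorbs the error. -/
theorem ApproximatesLinearOn.le_euclideanHausdorffMeasure_image
    (h : ApproximatesLinearOn G L s ε) (hG : ∀ a b, ‖a - b‖ ≤ ‖G a - G b‖) :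
    ENNReal.ofReal L.normDet * volume s ≤
      (1 + ε : ℝ≥0) ^ finrank ℝ F * μHE[finrank ℝ F] (G '' s) := by
  have hinj := injective_of_expanding hG
  rw [← InnerProductSpace.euclideanHausdorffMeasure_eq_volume,
    ← LinearMap.euclideanHausdorffMeasure_image]
  refine euclideanHausdorffMeasure_image_le_of_dist_le (hinj.injOn) fun x hx y hy => ?_
  have h1 := h x hx y hy
  have h2 := hG x y
  have h3 := norm_le_norm_add_norm_sub (G x - G y) (L (x - y))
  have h4 := mul_le_mul_of_nonneg_left h2 ε.coe_nonneg
  simp only [dist_eq_norm, ContinuousLinearMap.coe_coe, ← map_sub, NNReal.coe_add, NNReal.coe_one]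
  linarith

/-- Near each point the pulled-back measure lies between multiples of `normDet · volume` with
factors tending to 1. It is therefore locally finite and absolutely continuous, and Besicovitch
differentiation along small balls identifies its density. -/
theorem comap_euclideanHausdorffMeasure_eq_withDensity (hC : ContDiff ℝ 1 G)
    (hG : ∀ a b, ‖a - b‖ ≤ ‖G a - G b‖) :
    (μHE[finrank ℝ F]).comap G =
      volume.withDensity fun y => ENNReal.ofReal (fderiv ℝ G y : F →ₗ[ℝ] E).normDet := by
  have hinj := injective_of_expanding hG
  have hE : MeasurableEmbedding G := hC.continuous.measurableEmbedding hinj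
  set ν : Measure F := (μHE[finrank ℝ F]).comap G with hν
  have hνa : ∀ s, ν s = μHE[finrank ℝ F] (G '' s) := fun s => hE.comap_apply _ s
  have hd : ∀ x, DifferentiableAt ℝ G x := fun x => hC.differentiable (by norm_num) x
  have happ : ∀ x, ∀ ε : ℝ≥0, 0 < ε → ∃ s ∈ 𝓝 x, ApproximatesLinearOn G (fderiv ℝ G x) s ε := by
    intro x ε hε
    exact (hC.contDiffAt.hasStrictFDerivAt (by norm_num)).approximates_deriv_on_nhds
      (Or.inr hε)
  have hup : ∀ x, ∀ ε : ℝ≥0, 0 < ε → ∃ s ∈ 𝓝 x, ∀ a ⊆ s, ν a ≤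
      (1 + ε : ℝ≥0) ^ finrank ℝ F *
        (ENNReal.ofReal (fderiv ℝ G x : F →ₗ[ℝ] E).normDet * volume a) := by
    intro x ε hε
    obtain ⟨s, hs, h⟩ := happ x ε hε
    refine ⟨s, hs, fun a ha => ?_⟩
    rw [hνa]
    exact (h.mono_set ha).euclideanHausdorffMeasure_image_le
      (norm_le_norm_fderiv_of_expanding hG (hd x))
  have hlo : ∀ x, ∀ ε : ℝ≥0, 0 < ε → ∃ s ∈ 𝓝 x, ∀ a ⊆ s,
      ENNReal.ofReal (fderiv ℝ G x : F →ₗ[ℝ] E).normDet * volume a ≤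
      (1 + ε : ℝ≥0) ^ finrank ℝ F * ν a := by
    intro x ε hε
    obtain ⟨s, hs, h⟩ := happ x ε hε
    refine ⟨s, hs, fun a ha => ?_⟩
    rw [hνa]
    exact (h.mono_set ha).le_euclideanHausdorffMeasure_image hG
  have : IsLocallyFiniteMeasure ν := by
    constructor
    intro x
    obtain ⟨s, hs, h⟩ := hup x 1 one_pos
    refine ⟨s ∩ Metric.ball x 1, inter_mem hs (Metric.ball_mem_nhds x one_pos), ?_⟩
    refine (h _ inter_subset_left).trans_lt ?_
    have : volume (s ∩ Metric.ball x 1) < ∞ :=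
      (measure_mono inter_subset_right).trans_lt measure_ball_lt_top
    finiteness
  have hac : ν ≪ volume := by
    intro A hA
    refine measure_null_of_locally_null A fun x _ => ?_
    obtain ⟨s, hs, h⟩ := hup x 1 one_pos
    refine ⟨A ∩ s, inter_mem self_mem_nhdsWithin (mem_nhdsWithin_of_mem_nhds hs), ?_⟩
    have := h _ (inter_subset_right (s := A))
    rwa [measure_mono_null inter_subset_left hA, mul_zero, mul_zero, nonpos_iff_eq_zero] at this
  rw [← withDensity_rnDeriv_eq ν volume hac]
  refine withDensity_congr_ae ?_
  filter_upwards [(Besicovitch.vitaliFamily (volume : Measure F)).ae_tendsto_rnDeriv ν] with x hx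
  have hx' := hx.comp (Besicovitch.tendsto_filterAt volume x)
  set c := ν.rnDeriv volume x
  set J := ENNReal.ofReal (fderiv ℝ G x : F →ₗ[ℝ] E).normDet
  have hball : ∀ s ∈ 𝓝 x, ∀ᶠ r in 𝓝[>] (0:ℝ), Metric.closedBall x r ⊆ s := by
    intro s hs
    obtain ⟨δ, hδ, h⟩ := Metric.nhds_basis_closedBall.mem_iff.1 hs
    filter_upwards [Ioc_mem_nhdsGT hδ] with r hr
    exact (Metric.closedBall_subset_closedBall hr.2).trans h
  have hc1 : ∀ ε : ℝ≥0, 0 < ε → c ≤ ((1 + ε : ℝ≥0) ^ finrank ℝ F : ℝ≥0∞) * J := by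
    intro ε hε
    obtain ⟨s, hs, h⟩ := hup x ε hε
    refine le_of_tendsto hx' ?_
    filter_upwards [hball s hs] with r hr
    refine ENNReal.div_le_of_le_mul ?_
    rw [mul_assoc]
    exact h _ hr
  have hc2 : ∀ ε : ℝ≥0, 0 < ε → J ≤ ((1 + ε : ℝ≥0) ^ finrank ℝ F : ℝ≥0∞) * c := by
    intro ε hε
    obtain ⟨s, hs, h⟩ := hlo x ε hε
    refine ge_of_tendsto (ENNReal.Tendsto.const_mul hx' (Or.inr (by finiteness))) ?_
    filter_upwards [hball s hs, self_mem_nhdsWithin] with r hr hr0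
    have h1 := h _ hr
    simp only [Function.comp]
    rw [← mul_div_assoc, ENNReal.le_div_iff_mul_le]
    · exact h1
    · exact Or.inl (Metric.measure_closedBall_pos _ _ hr0).ne'
    · exact Or.inl measure_closedBall_lt_top.ne
  have hlim : ∀ z : ℝ≥0∞, Tendsto (fun ε : ℝ≥0 => ((1 + ε : ℝ≥0) ^ finrank ℝ F : ℝ≥0∞) * z)
      (𝓝[>] 0) (𝓝 z) := by
    intro z
    have h1 : Tendsto (fun ε : ℝ≥0 => (((1 + ε) ^ finrank ℝ F : ℝ≥0) : ℝ≥0∞)) (𝓝[>] 0)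
        (𝓝 (((1 + 0) ^ finrank ℝ F : ℝ≥0) : ℝ≥0∞)) := by
      rw [ENNReal.tendsto_coe]
      exact ((by fun_prop : Continuous fun ε : ℝ≥0 => (1 + ε) ^ finrank ℝ F).tendsto 0).mono_left
        nhdsWithin_le_nhds
    have h2 := ENNReal.Tendsto.mul_const (b := z) h1 (Or.inl (by simp))
    simpa using h2
  have hε0 : ∀ᶠ ε : ℝ≥0 in 𝓝[>] 0, 0 < ε := self_mem_nhdsWithin
  exact le_antisymm (ge_of_tendsto (hlim J) (hε0.mono hc1)) (ge_of_tendsto (hlim c) (hε0.mono hc2))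

/-- **Area formula** for an expanding `C¹` immersion. -/
theorem map_withDensity_normDet (hC : ContDiff ℝ 1 G) (hG : ∀ a b, ‖a - b‖ ≤ ‖G a - G b‖) :
    (volume.withDensity fun y => ENNReal.ofReal (fderiv ℝ G y : F →ₗ[ℝ] E).normDet).map G =
      (μHE[finrank ℝ F]).restrict (range G) := by
  have hinj := injective_of_expanding hG
  rw [← comap_euclideanHausdorffMeasure_eq_withDensity hC hG]
  exact (hC.continuous.measurableEmbedding hinj).map_comap _

end AreaFormula
end

noncomputable section

/-! ### Functions whose zero set is a graph over a hyperplane -/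

section GraphFunction

open Measure Module
open scoped NNReal ENNReal

variable {E : Type*} [NormedAddCommGroup E] [InnerProductSpace ℝ E]

/-- `ρ` is a `C²` function of the form `x ↦ ⟪e, x⟫ - g (proj x)` for a unit vector `e`, where `proj`
is the projection to the hyperplane orthogonal to `e`. -/
structure IsGraphFunction (e : E) (ρ : E → ℝ) : Prop where
  norm_eq : ‖e‖ = 1
  contDiff : ContDiff ℝ 2 ρ
  map_add_smul : ∀ x (t : ℝ), ρ (x + t • e) = ρ x + t

/-- The parametrization of the zero set of a graph function by the hyperplane `eᗮ`. -/
def graphMap (e : E) (ρ : E → ℝ) (y : (ℝ ∙ e)ᗮ) : E := (y : E) - ρ y • e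

namespace IsGraphFunction

variable {e : E} {ρ : E → ℝ}

theorem apply_graphMap_add (h : IsGraphFunction e ρ) (y : (ℝ ∙ e)ᗮ) (t : ℝ) :
    ρ (graphMap e ρ y + t • e) = t := by
  rw [graphMap, sub_eq_add_neg, ← neg_smul, h.map_add_smul, h.map_add_smul]
  ring

theorem apply_graphMap (h : IsGraphFunction e ρ) (y : (ℝ ∙ e)ᗮ) : ρ (graphMap e ρ y) = 0 := by
  simpa using h.apply_graphMap_add y 0

theorem continuous (h : IsGraphFunction e ρ) : Continuous ρ := h.contDiff.continuous

theorem differentiable (h : IsGraphFunction e ρ) : Differentiable ℝ ρ :=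
  h.contDiff.differentiable (by norm_num)

theorem graphMap_orthogonalProjectionOnto_add (h : IsGraphFunction e ρ) (x : E) :
    graphMap e ρ ((ℝ ∙ e)ᗮ.orthogonalProjectionOnto x) + ρ x • e = x := by
  have h1 : ((ℝ ∙ e)ᗮ.orthogonalProjectionOnto x : E) = x + (-(inner ℝ e x)) • e := by
    rw [← Submodule.starProjection_apply, Submodule.starProjection_orthogonal_val,
      Submodule.starProjection_unit_singleton ℝ h.norm_eq, neg_smul, ← sub_eq_add_neg]
  rw [graphMap, h1, h.map_add_smul]
  module

theorem range_graphMap (h : IsGraphFunction e ρ) : range (graphMap e ρ) = {x | ρ x = 0} := by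
  ext x
  constructor
  · rintro ⟨y, rfl⟩
    exact h.apply_graphMap y
  · intro hx
    have hx : ρ x = 0 := hx
    have := h.graphMap_orthogonalProjectionOnto_add x
    rw [hx, zero_smul, add_zero] at this
    exact ⟨_, this⟩

theorem fderiv_self (h : IsGraphFunction e ρ) (x : E) : fderiv ℝ ρ x e = 1 := by
  have h1 := ((h.differentiable x).hasFDerivAt.hasLineDerivAt e)
  have h2 : HasLineDerivAt ℝ ρ 1 x e := by
    simp only [HasLineDerivAt, h.map_add_smul]
    simpa using (hasDerivAt_id (0:ℝ)).const_add (ρ x)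
  exact h1.unique h2

theorem fderiv_add_smul (h : IsGraphFunction e ρ) (x : E) (t : ℝ) :
    fderiv ℝ ρ (x + t • e) = fderiv ℝ ρ x := by
  rw [← fderiv_comp_add_right]
  simp [h.map_add_smul]

theorem fderiv_graphMap_eq (h : IsGraphFunction e ρ) (y : (ℝ ∙ e)ᗮ) :
    fderiv ℝ ρ (graphMap e ρ y) = fderiv ℝ ρ y := by
  rw [graphMap, sub_eq_add_neg, ← neg_smul, h.fderiv_add_smul]

theorem contDiff_graphMap (h : IsGraphFunction e ρ) : ContDiff ℝ 2 (graphMap e ρ) := by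
  have h1 : ContDiff ℝ 2 (fun y : (ℝ ∙ e)ᗮ => (y : E)) := (ℝ ∙ e)ᗮ.subtypeL.contDiff
  exact h1.sub ((h.contDiff.comp h1).smul contDiff_const)

theorem hasFDerivAt_graphMap (h : IsGraphFunction e ρ) (y : (ℝ ∙ e)ᗮ) :
    HasFDerivAt (graphMap e ρ) ((ℝ ∙ e)ᗮ.subtypeL -
      ((fderiv ℝ ρ y).comp (ℝ ∙ e)ᗮ.subtypeL).smulRight e) y := by
  have h1 : HasFDerivAt (fun y : (ℝ ∙ e)ᗮ => (y : E)) (ℝ ∙ e)ᗮ.subtypeL y :=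
    (ℝ ∙ e)ᗮ.subtypeL.hasFDerivAt
  exact h1.sub (((h.differentiable (y : E)).hasFDerivAt.comp y h1).smul_const e)

/-- The difference of two graph points splits orthogonally into the difference of the base points
and a multiple of `e`, so lifting to the graph can only increase distances. -/
theorem expanding_graphMap (e : E) (ρ : E → ℝ) (a b : (ℝ ∙ e)ᗮ) :
    ‖a - b‖ ≤ ‖graphMap e ρ a - graphMap e ρ b‖ := by
  have h1 : graphMap e ρ a - graphMap e ρ b = ((a - b : (ℝ ∙ e)ᗮ) : E) + (ρ b - ρ a) • e := by
    simp only [graphMap, Submodule.coe_sub]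
    module
  have h2 : inner ℝ ((a - b : (ℝ ∙ e)ᗮ) : E) ((ρ b - ρ a) • e) = 0 := by
    rw [inner_smul_right, Submodule.mem_orthogonal_singleton_iff_inner_left.1 (a - b).2, mul_zero]
  have h3 := norm_add_sq_eq_norm_sq_add_norm_sq_of_inner_eq_zero _ _ h2
  rw [← h1] at h3
  change ‖((a - b : (ℝ ∙ e)ᗮ) : E)‖ ≤ _
  refine abs_le_of_sq_le_sq' ?_ (norm_nonneg _) |>.2
  nlinarith [norm_nonneg ((ρ b - ρ a) • e)]

theorem isHomeomorph_prod (h : IsGraphFunction e ρ) :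
    IsHomeomorph (fun p : (ℝ ∙ e)ᗮ × ℝ => graphMap e ρ p.1 + p.2 • e) := by
  have hc := h.contDiff_graphMap.continuous
  have hρ := h.continuous
  refine (Homeomorph.isHomeomorph ⟨⟨fun p : (ℝ ∙ e)ᗮ × ℝ => graphMap e ρ p.1 + p.2 • e,
    fun x => ((ℝ ∙ e)ᗮ.orthogonalProjectionOnto x, ρ x), ?_, ?_⟩, ?_, ?_⟩)
  · rintro ⟨y, t⟩
    ext1
    · have h1 : graphMap e ρ y + t • e = (y : E) + (t - ρ y) • e := by
        rw [graphMap]; module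
      have h2 : (ℝ ∙ e)ᗮ.orthogonalProjectionOnto e = 0 :=
        Submodule.orthogonalProjectionOnto_orthogonalComplement_singleton_eq_zero e
      simp [h1, h2]
    · exact h.apply_graphMap_add y t
  · exact fun x => h.graphMap_orthogonalProjectionOnto_add x
  · fun_prop
  · fun_prop

variable [FiniteDimensional ℝ E]

/-- With `p` the gradient and `a = p - e` its part in the hyperplane, the derivative is `v ↦ v - ⟪a,
v⟫ e`. Its Gram operator is the transvection `1 + a ⊗ a`, with determinant `1 + ‖a‖² = ‖p‖²`. -/
theorem normDet_fderiv_graphMap (h : IsGraphFunction e ρ) (y : (ℝ ∙ e)ᗮ) :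
    (fderiv ℝ (graphMap e ρ) y : (ℝ ∙ e)ᗮ →ₗ[ℝ] E).normDet =
      ‖gradient ρ (graphMap e ρ y)‖ := by
  rw [(h.hasFDerivAt_graphMap y).fderiv]
  set p := gradient ρ (graphMap e ρ y)
  have hp : ∀ v, fderiv ℝ ρ y v = inner ℝ p v := by
    intro v
    rw [← h.fderiv_graphMap_eq y, ← toDual_apply_apply (𝕜 := ℝ)]
    simp [p, gradient]
  set a : (ℝ ∙ e)ᗮ := (ℝ ∙ e)ᗮ.orthogonalProjectionOnto p
  have hpe : inner ℝ p e = 1 := by rw [← hp, h.fderiv_self]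
  have ha : ∀ v : (ℝ ∙ e)ᗮ, inner ℝ p v = inner ℝ a v := fun v =>
    (Submodule.inner_orthogonalProjectionOnto_eq_of_mem_right v p).symm
  have hea : (a : E) = p - e := by
    rw [← Submodule.starProjection_apply, Submodule.starProjection_orthogonal_val,
      Submodule.starProjection_unit_singleton ℝ h.norm_eq, real_inner_comm, hpe, one_smul]
  set L : (ℝ ∙ e)ᗮ →L[ℝ] E := (ℝ ∙ e)ᗮ.subtypeL -
      ((fderiv ℝ ρ y).comp (ℝ ∙ e)ᗮ.subtypeL).smulRight e
  have hL : ∀ v, L v = (v : E) - inner ℝ a v • e := by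
    intro v
    simp [L, hp, ha]
  have hadj : LinearMap.adjoint (L : (ℝ ∙ e)ᗮ →ₗ[ℝ] E) ∘ₗ (L : (ℝ ∙ e)ᗮ →ₗ[ℝ] E) =
      LinearMap.transvection (innerSL ℝ a).toLinearMap a := by
    ext v : 1
    refine ext_inner_right ℝ fun w => ?_
    have h1 : ∀ v : (ℝ ∙ e)ᗮ, inner ℝ e (v : E) = 0 := fun v =>
      Submodule.mem_orthogonal_singleton_iff_inner_right.1 v.2
    have h2 : ∀ v : (ℝ ∙ e)ᗮ, inner ℝ (v : E) e = 0 := fun v =>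
      Submodule.mem_orthogonal_singleton_iff_inner_left.1 v.2
    rw [LinearMap.comp_apply, LinearMap.adjoint_inner_left, LinearMap.transvection.apply]
    simp only [ContinuousLinearMap.coe_coe, hL, inner_sub_left, inner_sub_right, inner_add_left,
      real_inner_smul_left, real_inner_smul_right, h1, h2, real_inner_self_eq_norm_sq, h.norm_eq,
      innerSL_apply_apply, Submodule.coe_inner, Submodule.coe_smul]
    ring
  have hsq := LinearMap.normDet_sq (L : (ℝ ∙ e)ᗮ →ₗ[ℝ] E)
  rw [hadj, LinearMap.transvection.det] at hsq
  have h3 : (innerSL ℝ a).toLinearMap a = ‖p‖ ^ 2 - 1 := by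
    have : (innerSL ℝ a).toLinearMap a = inner ℝ (a : E) (a : E) := rfl
    rw [this, hea, inner_sub_left, inner_sub_right, inner_sub_right, real_inner_self_eq_norm_sq,
      real_inner_self_eq_norm_sq, h.norm_eq, real_inner_comm p e, hpe]
    ring
  rw [h3] at hsq
  refine (sq_eq_sq₀ (LinearMap.normDet_nonneg _) (norm_nonneg _)).1 ?_
  simpa using hsq

theorem norm_gradient_pos (h : IsGraphFunction e ρ) (x : E) : 0 < ‖gradient ρ x‖ := by
  rw [norm_pos_iff]
  intro h0
  have h1 := h.fderiv_self x
  have h2 : fderiv ℝ ρ x = 0 := by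
    simpa [gradient] using h0
  rw [h2] at h1
  simp at h1

theorem finrank_orthogonal (h : IsGraphFunction e ρ) :
    finrank ℝ (ℝ ∙ e)ᗮ = finrank ℝ E - 1 := by
  have h1 := Submodule.finrank_add_finrank_orthogonal (ℝ ∙ e)
  have he : e ≠ 0 := by
    rintro rfl
    simpa using h.norm_eq
  rw [finrank_span_singleton he] at h1
  omega

theorem continuous_gradient (h : IsGraphFunction e ρ) : Continuous (gradient ρ) := by
  have := h.contDiff.continuous_fderiv (by norm_num)
  unfold gradient
  fun_prop

variable [MeasurableSpace E] [BorelSpace E]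

theorem measurableEmbedding_graphMap (h : IsGraphFunction e ρ) :
    MeasurableEmbedding (graphMap e ρ) :=
  h.contDiff_graphMap.continuous.measurableEmbedding (injective_of_expanding (expanding_graphMap e ρ))

theorem restrict_zeroSet_eq_map (h : IsGraphFunction e ρ) :
    (μHE[finrank ℝ E - 1] : Measure E).restrict {x | ρ x = 0} =
      (volume.withDensity fun y => ENNReal.ofReal ‖gradient ρ (graphMap e ρ y)‖).map
        (graphMap e ρ) := by
  rw [← h.range_graphMap, ← h.finrank_orthogonal,
    ← map_withDensity_normDet (h.contDiff_graphMap.of_le (by norm_num)) (expanding_graphMap e ρ)]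
  simp_rw [h.normDet_fderiv_graphMap]

theorem setIntegral_zeroSet (h : IsGraphFunction e ρ) (q : E → ℝ) :
    ∫ x in {x | ρ x = 0}, q x ∂(μHE[finrank ℝ E - 1] : Measure E) =
      ∫ y, ‖gradient ρ (graphMap e ρ y)‖ * q (graphMap e ρ y) := by
  rw [h.restrict_zeroSet_eq_map, h.measurableEmbedding_graphMap.integral_map,
    integral_withDensity_eq_integral_toReal_smul]
  · simp
  · have := h.continuous_gradient
    have := h.contDiff_graphMap.continuous
    exact (ENNReal.continuous_ofReal.comp (by fun_prop)).measurable
  · simp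

/-- A vertical shear followed by the orthogonal splitting of the space into `eᗮ` and the line of
`e`. -/
theorem measurePreserving_prod (h : IsGraphFunction e ρ) :
    MeasurePreserving (fun p : (ℝ ∙ e)ᗮ × ℝ => graphMap e ρ p.1 + p.2 • e)
      (volume.prod volume) volume := by
  have h1 : MeasurePreserving (fun p : (ℝ ∙ e)ᗮ × ℝ => (p.1, p.2 - ρ p.1))
      (volume.prod volume) (volume.prod volume) := by
    refine (MeasurePreserving.id (volume : Measure (ℝ ∙ e)ᗮ)).skew_product
      (μc := volume) (μd := volume) (g := fun y t => t - ρ y) ?_ ?_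
    · have := h.continuous
      exact Continuous.measurable (by fun_prop)
    · refine Eventually.of_forall fun y => ?_
      exact (measurePreserving_sub_right volume (ρ y)).map_eq
  have h2 : MeasurePreserving (LinearIsometryEquiv.toSpanUnitSingleton (𝕜 := ℝ) e h.norm_eq)
      volume volume := LinearIsometryEquiv.measurePreserving _
  have h3 := ((ℝ ∙ e).measurePreserving_measurableEquivProd (0 : E)).symm
  rw [InnerProductSpace.euclideanHausdorffMeasure_eq_volume] at h3
  have h4 := (h3.comp (h2.prod (MeasurePreserving.id volume))).comp
    ((measurePreserving_swap (μ := (volume : Measure (ℝ ∙ e)ᗮ)) (ν := (volume : Measure ℝ))).comp h1)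
  convert! h4 using 1
  ext p
  simp [graphMap]
  module

theorem measurableEmbedding_prod (h : IsGraphFunction e ρ) :
    MeasurableEmbedding (fun p : (ℝ ∙ e)ᗮ × ℝ => graphMap e ρ p.1 + p.2 • e) :=
  h.isHomeomorph_prod.isClosedEmbedding.measurableEmbedding

end IsGraphFunction

end GraphFunction
end

noncomputable section

/-! ### The cutoff profile and integrals over thin layers. -/

section StepProfile

/-- A smooth step function, equal to `0` on `(-∞, 1]` and to `1` on `[2, ∞)`. -/
def stepProfile (r : ℝ) : ℝ := Real.smoothTransition (r - 1)

theorem contDiff_stepProfile {n : ℕ∞} : ContDiff ℝ n stepProfile :=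
  Real.smoothTransition.contDiff.comp (by fun_prop)

theorem stepProfile_of_le {r : ℝ} (h : r ≤ 1) : stepProfile r = 0 :=
  Real.smoothTransition.zero_of_nonpos (by linarith)

theorem stepProfile_of_ge {r : ℝ} (h : 2 ≤ r) : stepProfile r = 1 :=
  Real.smoothTransition.one_of_one_le (by linarith)

theorem abs_stepProfile_le (r : ℝ) : |stepProfile r| ≤ 1 := by
  rw [stepProfile, abs_of_nonneg (Real.smoothTransition.nonneg _)]
  exact Real.smoothTransition.le_one _

theorem hasDerivAt_stepProfile (r : ℝ) : HasDerivAt stepProfile (deriv stepProfile r) r :=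
  ((contDiff_stepProfile (n := 1)).differentiable (by norm_num) r).hasDerivAt

theorem continuous_deriv_stepProfile : Continuous (deriv stepProfile) :=
  (contDiff_stepProfile (n := 1)).continuous_deriv (by norm_num)

theorem deriv_stepProfile_eq_zero {r : ℝ} (h : r ∉ Icc (1:ℝ) 2) : deriv stepProfile r = 0 := by
  rw [mem_Icc, not_and_or, not_le, not_le] at h
  rcases h with h | h
  · have : stepProfile =ᶠ[𝓝 r] fun _ => 0 := by
      filter_upwards [Iio_mem_nhds h] with x hx using stepProfile_of_le (le_of_lt hx)
    rw [this.deriv_eq, deriv_const]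
  · have : stepProfile =ᶠ[𝓝 r] fun _ => 1 := by
      filter_upwards [Ioi_mem_nhds h] with x hx using stepProfile_of_ge (le_of_lt hx)
    rw [this.deriv_eq, deriv_const]

/-- The profile attains its minimum there. This includes the endpoint `r = 1`, which
`deriv_stepProfile_eq_zero` leaves out. -/
theorem deriv_stepProfile_of_le {r : ℝ} (h : r ≤ 1) : deriv stepProfile r = 0 := by
  refine IsLocalMin.deriv_eq_zero (Eventually.of_forall fun x => ?_)
  rw [stepProfile_of_le h]
  exact Real.smoothTransition.nonneg _

theorem integral_deriv_stepProfile : ∫ r, deriv stepProfile r = 1 := by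
  have h1 : ∫ r in (0:ℝ)..3, deriv stepProfile r = stepProfile 3 - stepProfile 0 :=
    intervalIntegral.integral_deriv_eq_sub (fun x _ => (hasDerivAt_stepProfile x).differentiableAt)
      (continuous_deriv_stepProfile.intervalIntegrable _ _)
  rw [stepProfile_of_le (r := 0) (by norm_num), stepProfile_of_ge (r := 3) (by norm_num),
    intervalIntegral.integral_of_le (by norm_num)] at h1
  rw [← setIntegral_eq_integral_of_forall_compl_eq_zero (s := Ioc (0:ℝ) 3), h1]
  · norm_num
  · intro x hx
    refine deriv_stepProfile_eq_zero fun h => hx ⟨?_, ?_⟩ <;> linarith [h.1, h.2]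

end StepProfile

namespace IsGraphFunction

variable {E : Type*} [NormedAddCommGroup E] [InnerProductSpace ℝ E] {e : E} {ρ : E → ℝ}
  [FiniteDimensional ℝ E] [MeasurableSpace E] [BorelSpace E]

/-- The integral over the graph `{ρ = 0}` as a limit of integrals over thin layers below it. -/
theorem tendsto_integral_layer (h : IsGraphFunction e ρ) {q : E → ℝ}
    (hq : ContinuousOn q {x | ρ x ≤ 0}) {K : Set E} (hK : IsCompact K)
    (hqK : ∀ x ∉ K, ρ x ≤ 0 → q x = 0) :
    Tendsto (fun s : ℝ => ∫ x, s⁻¹ * deriv stepProfile (-ρ x / s) * q x) (𝓝[>] 0)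
      (𝓝 (∫ y, q (graphMap e ρ y))) := by
  have hcG := h.contDiff_graphMap.continuous
  have hcρ := h.continuous
  set q' : E → ℝ := fun x => q (x - max (ρ x) 0 • e) with hq'
  have hle : ∀ x, ρ (x - max (ρ x) 0 • e) ≤ 0 := by
    intro x
    rw [sub_eq_add_neg, ← neg_smul, h.map_add_smul]
    linarith [le_max_left (ρ x) 0]
  have hcq' : Continuous q' :=
    hq.comp_continuous (by fun_prop) hle
  have hqq' : ∀ x, ρ x ≤ 0 → q' x = q x := by
    intro x hx
    simp [hq', max_eq_right hx]
  set K' : Set (ℝ ∙ e)ᗮ := (fun x => (ℝ ∙ e)ᗮ.orthogonalProjectionOnto x) '' K with hK'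
  have hK'c : IsCompact K' := hK.image (by fun_prop)
  have hproj : ∀ (y : (ℝ ∙ e)ᗮ) (t : ℝ),
      (ℝ ∙ e)ᗮ.orthogonalProjectionOnto (graphMap e ρ y + t • e) = y := by
    intro y t
    have h1 : graphMap e ρ y + t • e = (y : E) + (t - ρ y) • e := by
      rw [graphMap]; module
    simp [h1, Submodule.orthogonalProjectionOnto_orthogonalComplement_singleton_eq_zero e]
  have hvan : ∀ (t : ℝ) (y : (ℝ ∙ e)ᗮ), y ∉ K' → q' (graphMap e ρ y + t • e) = 0 := by
    intro t y hy
    refine hqK _ (fun hx => hy ⟨_, hx, ?_⟩) (hle _)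
    rw [add_sub_assoc, ← sub_smul]
    exact hproj _ _
  set Φ : ℝ → ℝ := fun t => ∫ y, q' (graphMap e ρ y + t • e) with hΦ
  have hΦc : Continuous Φ := by
    rw [← continuousOn_univ]
    refine continuousOn_integral_of_compact_support hK'c (Continuous.continuousOn ?_)
      (fun t y _ hy => hvan t y hy)
    simp only [Function.uncurry_def]
    fun_prop
  have hkc := continuous_deriv_stepProfile
  -- Fubini in the coordinates `(y, t)`, where `ρ = t`, and the substitution `t = -s r`. The right
  -- side is continuous in `s` down to `s = 0`.
  have hformula : ∀ s : ℝ, 0 < s → ∫ x, s⁻¹ * deriv stepProfile (-ρ x / s) * q x =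
      ∫ r, deriv stepProfile r * Φ (-s * r) := by
    intro s hs
    have h1 : ∀ x, s⁻¹ * deriv stepProfile (-ρ x / s) * q x =
        s⁻¹ * deriv stepProfile (-ρ x / s) * q' x := by
      intro x
      by_cases hx : ρ x ≤ 0
      · rw [hqq' x hx]
      · rw [deriv_stepProfile_eq_zero]
        · simp
        · intro hm
          have : -ρ x / s < 0 := div_neg_of_neg_of_pos (by linarith) hs
          linarith [hm.1]
    simp_rw [h1]
    rw [← h.measurePreserving_prod.integral_comp h.measurableEmbedding_prod]
    simp_rw [h.apply_graphMap_add]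
    rw [integral_prod_symm]
    · have h2 := Measure.integral_comp_mul_left
        (fun t => s⁻¹ * deriv stepProfile (-t / s) * Φ t) (-s)
      have h3 : ∀ r, s⁻¹ * deriv stepProfile (-(-s * r) / s) * Φ (-s * r) =
          s⁻¹ * (deriv stepProfile r * Φ (-s * r)) := by
        intro r
        rw [neg_mul, neg_neg, mul_div_cancel_left₀ _ hs.ne']
        ring
      simp_rw [h3] at h2
      rw [integral_const_mul, abs_inv, abs_neg, abs_of_pos hs, smul_eq_mul] at h2
      have h4 := mul_left_cancel₀ (inv_ne_zero hs.ne') h2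
      rw [h4]
      refine integral_congr_ae (Eventually.of_forall fun t => ?_)
      simp only [hΦ]
      rw [integral_const_mul]
    · refine Continuous.integrable_of_hasCompactSupport ?_ ?_
      · fun_prop
      · refine HasCompactSupport.intro (hK'c.prod (isCompact_Icc (a := -(2 * s)) (b := 0))) ?_
        rintro ⟨y, t⟩ hp
        rw [mem_prod, not_and_or] at hp
        rcases hp with hp | hp
        · simp only [hvan t y hp, mul_zero]
        · rw [deriv_stepProfile_eq_zero, mul_zero, zero_mul]
          rintro ⟨ht1, ht2⟩
          rw [le_div_iff₀ hs] at ht1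
          rw [div_le_iff₀ hs] at ht2
          exact hp ⟨by dsimp only at *; linarith, by dsimp only at *; linarith⟩
  have hlim : Continuous fun s : ℝ => ∫ r, deriv stepProfile r * Φ (-s * r) := by
    rw [← continuousOn_univ]
    refine continuousOn_integral_of_compact_support (isCompact_Icc (a := (1:ℝ)) (b := 2))
      (Continuous.continuousOn ?_) (fun t r _ hr => by rw [deriv_stepProfile_eq_zero hr, zero_mul])
    simp only [Function.uncurry_def]
    fun_prop
  have h0 : ∫ r, deriv stepProfile r * Φ (-0 * r) = ∫ y, q (graphMap e ρ y) := by
    simp only [neg_zero, zero_mul]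
    rw [integral_mul_const, integral_deriv_stepProfile, one_mul]
    refine integral_congr_ae (Eventually.of_forall fun y => ?_)
    simp only [zero_smul, add_zero]
    exact hqq' _ (h.apply_graphMap y).le
  rw [← h0]
  refine ((hlim.tendsto 0).mono_left nhdsWithin_le_nhds).congr' ?_
  filter_upwards [self_mem_nhdsWithin] with s hs
  exact (hformula s hs).symm

end IsGraphFunction
end

noncomputable section

/-! ### Divergence as a trace, and its vanishing integral. -/

section Trace

variable {E : Type*} [NormedAddCommGroup E] [InnerProductSpace ℝ E] [FiniteDimensional ℝ E]

/-- The trace as a continuous linear functional on endomorphisms. -/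
def traceCLM (E : Type*) [NormedAddCommGroup E] [InnerProductSpace ℝ E] [FiniteDimensional ℝ E] :
    (E →L[ℝ] E) →L[ℝ] ℝ :=
  LinearMap.toContinuousLinearMap (LinearMap.trace ℝ E ∘ₗ ContinuousLinearMap.coeLM ℝ)

theorem traceCLM_apply (A : E →L[ℝ] E) : traceCLM E A = LinearMap.trace ℝ E A := rfl

theorem traceCLM_smulRight (f : E →L[ℝ] ℝ) (v : E) : traceCLM E (f.smulRight v) = f v :=
  LinearMap.trace_smulRight _ _

theorem traceCLM_eq_sum_inner {ι : Type*} [Fintype ι] (b : OrthonormalBasis ι ℝ E)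
    (A : E →L[ℝ] E) : traceCLM E A = ∑ i, inner ℝ (b i) (A (b i)) :=
  LinearMap.trace_eq_sum_inner _ b

variable [MeasurableSpace E] [BorelSpace E]

theorem integral_fderiv_apply_eq_zero {f : E → ℝ} (hf : ContDiff ℝ 1 f)
    (hs : HasCompactSupport f) (v : E) : ∫ x, fderiv ℝ f x v = 0 := by
  have hc : Continuous fun x => fderiv ℝ f x v :=
    (hf.continuous_fderiv (by norm_num)).clm_apply continuous_const
  have hc' : HasCompactSupport fun x => fderiv ℝ f x v := hs.fderiv_apply (𝕜 := ℝ) v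
  have := integral_mul_fderiv_eq_neg_fderiv_mul_of_integrable (μ := volume)
    (f := fun _ : E => (1:ℝ)) (g := f) (v := v)
    (by simp) (by simpa using hc.integrable_of_hasCompactSupport hc')
    (by simpa using hf.continuous.integrable_of_hasCompactSupport hs) (by simp)
    (fun x _ => hf.differentiable (by norm_num) x)
  simpa using this

/-- The divergence of a compactly supported `C¹` field integrates to zero. -/
theorem integral_traceCLM_fderiv_eq_zero {X : E → E} (hX : ContDiff ℝ 1 X)
    (hs : HasCompactSupport X) : ∫ x, traceCLM E (fderiv ℝ X x) = 0 := by
  set b := stdOrthonormalBasis ℝ E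
  have hXi : ∀ i, ContDiff ℝ 1 fun x => inner ℝ (b i) (X x) := fun i => contDiff_const.inner ℝ hX
  have hsi : ∀ i, HasCompactSupport fun x => inner ℝ (b i) (X x) := fun i =>
    hs.comp_left (g := fun v => inner ℝ (b i) v) (inner_zero_right _)
  have hd : ∀ i x, fderiv ℝ (fun x => inner ℝ (b i) (X x)) x (b i) =
      inner ℝ (b i) (fderiv ℝ X x (b i)) := by
    intro i x
    rw [fderiv_inner_apply ℝ (by fun_prop) (hX.differentiable (by norm_num) x)]
    simp
  simp_rw [traceCLM_eq_sum_inner b, ← hd]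
  rw [integral_finsetSum]
  · exact Finset.sum_eq_zero fun i _ => integral_fderiv_apply_eq_zero (hXi i) (hsi i) _
  · intro i _
    exact (((hXi i).continuous_fderiv (by norm_num)).clm_apply
      continuous_const).integrable_of_hasCompactSupport ((hsi i).fderiv_apply (𝕜 := ℝ) _)

end Trace

/-! ### Derivatives of the normalized gradient. -/

section UnitGradient

variable {E : Type*} [NormedAddCommGroup E] [InnerProductSpace ℝ E] [CompleteSpace E]

/-- The normalized gradient of a function. -/
def unitGradient (ρ : E → ℝ) (x : E) : E := ‖gradient ρ x‖⁻¹ • gradient ρ x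

variable {ρ : E → ℝ} {x : E}

theorem norm_unitGradient (h : gradient ρ x ≠ 0) : ‖unitGradient ρ x‖ = 1 := by
  simp [unitGradient, norm_smul, norm_ne_zero_iff.2 h]

theorem norm_gradient_smul_unitGradient (h : gradient ρ x ≠ 0) :
    ‖gradient ρ x‖ • unitGradient ρ x = gradient ρ x := by
  rw [unitGradient, smul_smul, mul_inv_cancel₀ (norm_ne_zero_iff.2 h), one_smul]

theorem ContDiffAt.gradient {m n : WithTop ℕ∞} (h : ContDiffAt ℝ n ρ x) (hmn : m + 1 ≤ n) :
    ContDiffAt ℝ m (gradient ρ) x := by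
  have := h.fderiv_right hmn
  exact (toDual ℝ E).symm.toContinuousLinearEquiv.toContinuousLinearMap.contDiff.contDiffAt.comp x
    this

theorem inner_fderiv_gradient_left (h : ContDiffAt ℝ 2 ρ x) (v w : E) :
    inner ℝ (fderiv ℝ (gradient ρ) x v) w = fderiv ℝ (fderiv ℝ ρ) x v w := by
  have h1 : DifferentiableAt ℝ (gradient ρ) x :=
    (h.gradient (m := 1) (by norm_num)).differentiableAt (by norm_num)
  have h2 : DifferentiableAt ℝ (fderiv ℝ ρ) x :=
    (h.fderiv_right (m := 1) (by norm_num)).differentiableAt (by norm_num)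
  have h3 : fderiv ℝ ρ = (toDual ℝ E) ∘ gradient ρ := toDual_comp_gradient.symm
  have h4 : HasFDerivAt (fderiv ℝ ρ)
      ((toDual ℝ E).toContinuousLinearEquiv.toContinuousLinearMap.comp (fderiv ℝ (gradient ρ) x))
      x := by
    conv => enter [1]; rw [h3]
    exact ((toDual ℝ E).toContinuousLinearEquiv.toContinuousLinearMap.hasFDerivAt).comp x
      h1.hasFDerivAt
  rw [h4.fderiv]
  simp

theorem inner_fderiv_gradient_comm (h : ContDiffAt ℝ 2 ρ x) (v w : E) :
    inner ℝ (fderiv ℝ (gradient ρ) x v) w = inner ℝ v (fderiv ℝ (gradient ρ) x w) := by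
  rw [real_inner_comm _ v, inner_fderiv_gradient_left h, inner_fderiv_gradient_left h]
  exact (h.isSymmSndFDerivAt (by simp)).eq v w

theorem ContDiffAt.unitGradient (h : ContDiffAt ℝ 2 ρ x) (h0 : _root_.gradient ρ x ≠ 0) :
    ContDiffAt ℝ 1 (unitGradient ρ) x := by
  have h1 := h.gradient (m := 1) (by norm_num)
  exact ((h1.norm ℝ h0).inv (norm_ne_zero_iff.2 h0)).smul h1

theorem fderiv_gradient_apply_eq (h : ContDiffAt ℝ 2 ρ x) (h0 : gradient ρ x ≠ 0) (v : E) :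
    fderiv ℝ (gradient ρ) x v = fderiv ℝ (fun x => ‖gradient ρ x‖) x v • unitGradient ρ x +
      ‖gradient ρ x‖ • fderiv ℝ (unitGradient ρ) x v := by
  have h1 := h.gradient (m := 1) (by norm_num)
  have h2 : DifferentiableAt ℝ (fun x => ‖gradient ρ x‖) x :=
    (h1.norm ℝ h0).differentiableAt (by norm_num)
  have h3 : DifferentiableAt ℝ (unitGradient ρ) x :=
    (h.unitGradient h0).differentiableAt (by norm_num)
  have h4 : gradient ρ =ᶠ[𝓝 x] fun x => ‖gradient ρ x‖ • unitGradient ρ x := by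
    filter_upwards [h1.continuousAt.eventually_ne h0] with y hy
    exact (norm_gradient_smul_unitGradient hy).symm
  rw [h4.fderiv_eq, fderiv_fun_smul h2 h3]
  simp [add_comm]

theorem inner_fderiv_unitGradient_self (h : ContDiffAt ℝ 2 ρ x) (h0 : gradient ρ x ≠ 0) (v : E) :
    inner ℝ (fderiv ℝ (unitGradient ρ) x v) (unitGradient ρ x) = 0 := by
  have h1 := h.gradient (m := 1) (by norm_num)
  have h3 : DifferentiableAt ℝ (unitGradient ρ) x :=
    (h.unitGradient h0).differentiableAt (by norm_num)
  have h4 : (fun x => inner ℝ (unitGradient ρ x) (unitGradient ρ x)) =ᶠ[𝓝 x] fun _ => (1:ℝ) := by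
    filter_upwards [h1.continuousAt.eventually_ne h0] with y hy
    rw [real_inner_self_eq_norm_sq, norm_unitGradient hy, one_pow]
  have h5 := fderiv_inner_apply ℝ h3 h3 v
  rw [h4.fderiv_eq] at h5
  rw [real_inner_comm] at h5
  simp only [fderiv_fun_const, Pi.zero_apply, zero_apply] at h5
  linarith

/-- Symmetry of the Hessian of `ρ`, tested on `(n, w)` with `n` the unit gradient and expanded by
the product rule for `∇ρ = ‖∇ρ‖ n`. It makes the derivatives of `‖∇ρ‖` disappear from the surface
divergence theorem. -/
theorem norm_gradient_mul_inner_fderiv_unitGradient (h : ContDiffAt ℝ 2 ρ x)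
    (h0 : gradient ρ x ≠ 0) (w : E) :
    ‖gradient ρ x‖ * inner ℝ (fderiv ℝ (unitGradient ρ) x (unitGradient ρ x)) w =
      fderiv ℝ (fun x => ‖gradient ρ x‖) x (w - inner ℝ (unitGradient ρ x) w • unitGradient ρ x) := by
  have h1 := inner_fderiv_gradient_comm h (unitGradient ρ x) w
  rw [fderiv_gradient_apply_eq h h0, fderiv_gradient_apply_eq h h0, inner_add_left, inner_add_right,
    real_inner_smul_left, real_inner_smul_left, real_inner_smul_right, real_inner_smul_right,
    real_inner_comm (fderiv ℝ (unitGradient ρ) x w), inner_fderiv_unitGradient_self h h0,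
    real_inner_self_eq_norm_sq, norm_unitGradient h0] at h1
  rw [map_sub, map_smul, smul_eq_mul]
  linarith

end UnitGradient
end

noncomputable section

/-! ### Divergence theorem and surface divergence theorem on one subgraph. -/

namespace IsGraphFunction

variable {E : Type*} [NormedAddCommGroup E] [InnerProductSpace ℝ E] {e : E} {ρ : E → ℝ}

/-- A field on `{ρ < 0}` times a function of `ρ` vanishing near `{0 ≤ ρ}` is globally `C¹`. -/
theorem contDiff_comp_div_smul (h : IsGraphFunction e ρ) {k : ℝ → ℝ} (hk : ContDiff ℝ 1 k)
    (hk1 : ∀ r ≤ 1, k r = 0) {s : ℝ} (hs : 0 < s) {W : E → E}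
    (hW : ContDiffOn ℝ 1 W {x | ρ x < 0}) :
    ContDiff ℝ 1 (fun x => k (-ρ x / s) • W x) := by
  refine contDiff_iff_contDiffAt.2 fun x => ?_
  have hρ1 : ContDiff ℝ 1 ρ := h.contDiff.of_le (by norm_num)
  by_cases hx : ρ x < 0
  · have hS : {x | ρ x < 0} ∈ 𝓝 x := (isOpen_lt h.continuous continuous_const).mem_nhds hx
    exact (hk.comp (hρ1.neg.div_const s)).contDiffAt.smul (hW.contDiffAt hS)
  · have : (fun x => k (-ρ x / s) • W x) =ᶠ[𝓝 x] fun _ => 0 := by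
      have h2 : {y | -s < ρ y} ∈ 𝓝 x :=
        (isOpen_lt continuous_const h.continuous).mem_nhds (by
          have : 0 ≤ ρ x := not_lt.1 hx
          simp only [mem_ofPred_eq]; linarith)
      filter_upwards [h2] with y hy
      rw [hk1, zero_smul]
      rw [div_le_one hs]
      linarith [show -s < ρ y from hy]
    exact contDiffAt_const.congr_of_eventuallyEq this

theorem hasFDerivAt_comp_div_smul (h : IsGraphFunction e ρ) {k : ℝ → ℝ} (hk : ContDiff ℝ 1 k)
    {s : ℝ} {W : E → E} {x : E}
    (hW : DifferentiableAt ℝ W x) :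
    HasFDerivAt (fun x => k (-ρ x / s) • W x)
      (k (-ρ x / s) • fderiv ℝ W x +
        ((-(s⁻¹ * deriv k (-ρ x / s))) • fderiv ℝ ρ x).smulRight (W x)) x := by
  have h1 : HasFDerivAt (fun x => -ρ x / s) ((-s⁻¹) • fderiv ℝ ρ x) x := by
    have := (h.differentiable x).hasFDerivAt.const_mul (-s⁻¹)
    convert! this using 1
    ext y
    ring
  have h2 := ((hk.differentiable (by norm_num) (-ρ x / s)).hasDerivAt.comp_hasFDerivAt x h1)
  convert! h2.smul hW.hasFDerivAt using 1
  rw [smul_smul]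
  congr 3
  ring

variable [FiniteDimensional ℝ E]

theorem gradient_ne_zero (h : IsGraphFunction e ρ) (x : E) : gradient ρ x ≠ 0 :=
  norm_pos_iff.1 (h.norm_gradient_pos x)

theorem contDiff_unitGradient (h : IsGraphFunction e ρ) : ContDiff ℝ 1 (unitGradient ρ) :=
  contDiff_iff_contDiffAt.2 fun x => h.contDiff.contDiffAt.unitGradient (h.gradient_ne_zero x)

theorem contDiff_norm_gradient (h : IsGraphFunction e ρ) :
    ContDiff ℝ 1 (fun x => ‖gradient ρ x‖) :=
  contDiff_iff_contDiffAt.2 fun x =>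
    (h.contDiff.contDiffAt.gradient (m := 1) (by norm_num)).norm ℝ (h.gradient_ne_zero x)

variable [MeasurableSpace E] [BorelSpace E]

/-- **Divergence theorem** on a `C²` subgraph, for a compactly supported field which is `C¹` in the
interior and continuous up to the boundary. -/
theorem setIntegral_divergence (h : IsGraphFunction e ρ) {W : E → E}
    (hW : ContDiffOn ℝ 1 W {x | ρ x < 0}) (hWc : ContinuousOn W {x | ρ x ≤ 0})
    (hWs : HasCompactSupport W)
    (hint : IntegrableOn (fun x => traceCLM E (fderiv ℝ W x)) {x | ρ x < 0}) :
    ∫ x in {x | ρ x < 0}, traceCLM E (fderiv ℝ W x) =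
      ∫ y, fderiv ℝ ρ (graphMap e ρ y) (W (graphMap e ρ y)) := by
  set S : Set E := {x | ρ x < 0} with hSdef
  have hS : IsOpen S := isOpen_lt h.continuous continuous_const
  have hρ1 : Continuous (fderiv ℝ ρ) := h.contDiff.continuous_fderiv (by norm_num)
  have hq : ContinuousOn (fun x => fderiv ℝ ρ x (W x)) {x | ρ x ≤ 0} :=
    hρ1.continuousOn.clm_apply hWc
  have hlim := h.tendsto_integral_layer hq hWs.isCompact (fun x hx _ => by
    rw [image_eq_zero_of_notMem_tsupport hx, map_zero])
  -- The divergence of cutoff times `W` has integral zero. Differentiating the cutoff yields exactly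
  -- the layer weight, so letting `s → 0` on the two sides gives the two sides of the theorem.
  have hdiv : ∀ s : ℝ, 0 < s → ∫ x, s⁻¹ * deriv stepProfile (-ρ x / s) * fderiv ℝ ρ x (W x) =
      ∫ x in S, stepProfile (-ρ x / s) * traceCLM E (fderiv ℝ W x) := by
    intro s hs
    have h1 := h.contDiff_comp_div_smul (contDiff_stepProfile (n := 1))
      (fun r hr => stepProfile_of_le hr) hs hW
    have h2 := integral_traceCLM_fderiv_eq_zero h1 hWs.smul_left
    have hout : ∀ x, x ∉ S → -ρ x / s ≤ 0 := by
      intro x hx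
      have : 0 ≤ ρ x := not_lt.1 hx
      exact div_nonpos_of_nonpos_of_nonneg (by linarith) hs.le
    have h3 : ∫ x in S, traceCLM E (fderiv ℝ (fun x => stepProfile (-ρ x / s) • W x) x) = 0 := by
      rw [setIntegral_eq_integral_of_forall_compl_eq_zero, h2]
      intro x hx
      have : (fun x => stepProfile (-ρ x / s) • W x) =ᶠ[𝓝 x] fun _ => 0 := by
        have h2 : {y | -s < ρ y} ∈ 𝓝 x :=
          (isOpen_lt continuous_const h.continuous).mem_nhds (by
            have : 0 ≤ ρ x := not_lt.1 hx
            simp only [mem_ofPred_eq]; linarith)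
        filter_upwards [h2] with y hy
        rw [stepProfile_of_le, zero_smul]
        rw [div_le_one hs]
        linarith [show -s < ρ y from hy]
      rw [this.fderiv_eq]
      simp
    have h4 : ∀ x ∈ S, traceCLM E (fderiv ℝ (fun x => stepProfile (-ρ x / s) • W x) x) =
        stepProfile (-ρ x / s) * traceCLM E (fderiv ℝ W x) -
          s⁻¹ * deriv stepProfile (-ρ x / s) * fderiv ℝ ρ x (W x) := by
      intro x hx
      have hd : DifferentiableAt ℝ W x :=
        (hW.contDiffAt (hS.mem_nhds hx)).differentiableAt (by norm_num)
      rw [(h.hasFDerivAt_comp_div_smul (contDiff_stepProfile (n := 1)) hd).fderiv, map_add,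
        map_smul, traceCLM_smulRight]
      simp only [smul_apply, smul_eq_mul]
      ring
    rw [setIntegral_congr_fun hS.measurableSet h4] at h3
    have hi1 : IntegrableOn (fun x => stepProfile (-ρ x / s) * traceCLM E (fderiv ℝ W x)) S := by
      refine Integrable.bdd_mul hint (c := 1) ?_ ?_
      · have := (contDiff_stepProfile (n := 1)).continuous
        have := h.continuous
        exact (by fun_prop : Continuous fun x => stepProfile (-ρ x / s)).aestronglyMeasurable
      · exact Eventually.of_forall fun x => abs_stepProfile_le _
    have hi2 : IntegrableOn (fun x => traceCLM E
        (fderiv ℝ (fun x => stepProfile (-ρ x / s) • W x) x)) S := by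
      refine Integrable.integrableOn ?_
      have hc : Continuous (fderiv ℝ (fun x => stepProfile (-ρ x / s) • W x)) :=
        h1.continuous_fderiv (by norm_num)
      refine Continuous.integrable_of_hasCompactSupport (by fun_prop) ?_
      exact (hWs.smul_left.fderiv (𝕜 := ℝ)).comp_left (g := traceCLM E) (map_zero _)
    have hi3 : IntegrableOn
        (fun x => s⁻¹ * deriv stepProfile (-ρ x / s) * fderiv ℝ ρ x (W x)) S := by
      refine (hi1.sub hi2).congr_fun (fun x hx => ?_) hS.measurableSet
      simp only [Pi.sub_apply]
      rw [h4 x hx]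
      ring
    rw [integral_sub hi1 hi3] at h3
    rw [← setIntegral_eq_integral_of_forall_compl_eq_zero (s := S)]
    · linarith
    · intro x hx
      rw [deriv_stepProfile_eq_zero]
      · simp
      · intro hm
        linarith [hm.1, hout x hx]
  have hlim2 : Tendsto (fun s : ℝ => ∫ x in S, stepProfile (-ρ x / s) * traceCLM E (fderiv ℝ W x))
      (𝓝[>] 0) (𝓝 (∫ x in S, traceCLM E (fderiv ℝ W x))) := by
    refine tendsto_integral_filter_of_dominated_convergence
      (fun x => ‖traceCLM E (fderiv ℝ W x)‖) ?_ ?_ hint.norm ?_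
    · refine Eventually.of_forall fun s => ?_
      have := (contDiff_stepProfile (n := 1)).continuous
      have := h.continuous
      exact ((by fun_prop : Continuous fun x => stepProfile (-ρ x / s)).aestronglyMeasurable).mul
        hint.aestronglyMeasurable
    · refine Eventually.of_forall fun s => Eventually.of_forall fun x => ?_
      rw [norm_mul]
      exact mul_le_of_le_one_left (norm_nonneg _) (abs_stepProfile_le _)
    · refine (ae_restrict_mem hS.measurableSet).mono fun x hx => ?_
      refine tendsto_const_nhds.congr' ?_
      have hx : ρ x < 0 := hx
      -- For `s ≤ -ρ x / 2` the argument `-ρ x / s` is at least 2, where the profile equals 1.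
      filter_upwards [Ioc_mem_nhdsGT (show (0:ℝ) < -ρ x / 2 by linarith)] with s hs
      rw [stepProfile_of_ge, one_mul]
      rw [le_div_iff₀ hs.1]
      linarith [hs.2]
  refine tendsto_nhds_unique hlim2 (hlim.congr' ?_)
  filter_upwards [self_mem_nhdsWithin] with s hs
  exact hdiv s hs

/-- **Surface divergence theorem** on a `C²` graph, for a compactly supported field of class `C¹`
up to the boundary of the subgraph. -/
theorem integral_surfaceDivergence (h : IsGraphFunction e ρ) {w : E → E} {Dw : E → E →L[ℝ] E}
    (hw : ContDiffOn ℝ 1 w {x | ρ x < 0}) (hwc : ContinuousOn w {x | ρ x ≤ 0})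
    (hDw : ∀ x, ρ x < 0 → fderiv ℝ w x = Dw x) (hDwc : ContinuousOn Dw {x | ρ x ≤ 0})
    (hws : HasCompactSupport w) {K : Set E} (hK : IsCompact K) (hwK : ∀ x ∉ K, w x = 0)
    (hDwK : ∀ x ∉ K, Dw x = 0) :
    ∫ y, (fun x => ‖gradient ρ x‖ * (traceCLM E (Dw x) -
      inner ℝ (Dw x (unitGradient ρ x)) (unitGradient ρ x) -
      traceCLM E (fderiv ℝ (unitGradient ρ) x) * inner ℝ (w x) (unitGradient ρ x)))
        (graphMap e ρ y) = 0 := by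
  set n := unitGradient ρ with hn
  set q : E → ℝ := fun x => ‖gradient ρ x‖ * (traceCLM E (Dw x) - inner ℝ (Dw x (n x)) (n x) -
      traceCLM E (fderiv ℝ n x) * inner ℝ (w x) (n x)) with hq
  have hnC := h.contDiff_unitGradient
  have hrC := h.contDiff_norm_gradient
  have hnc : Continuous n := hnC.continuous
  have hrc := hrC.continuous
  have hDn : Continuous (fderiv ℝ n) := hnC.continuous_fderiv (by norm_num)
  have hqc : ContinuousOn q {x | ρ x ≤ 0} := by
    have := hDwc.clm_apply hnc.continuousOn
    exact hrc.continuousOn.mul ((((traceCLM E).continuous.comp_continuousOn hDwc).sub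
      (this.inner hnc.continuousOn)).sub
      (((traceCLM E).continuous.comp hDn).continuousOn.mul (hwc.inner hnc.continuousOn)))
  have hlim := h.tendsto_integral_layer hqc hK (fun x hx _ => by simp [hq, hwK x hx, hDwK x hx])
  refine tendsto_nhds_unique hlim (tendsto_const_nhds.congr' ?_)
  filter_upwards [self_mem_nhdsWithin] with s hs
  have hs : 0 < s := hs
  -- The tangential part of `w`, weighted by the area density. It is tangent to every level set of
  -- `ρ`, so a cutoff in `ρ` contributes nothing to the divergence.
  set A : E → E := fun x => ‖gradient ρ x‖ • (w x - inner ℝ (w x) (n x) • n x) with hA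
  have hAC : ContDiffOn ℝ 1 A {x | ρ x < 0} :=
    hrC.contDiffOn.smul (hw.sub ((hw.inner ℝ hnC.contDiffOn).smul hnC.contDiffOn))
  have hk : ContDiff ℝ 1 (deriv stepProfile) := by
    have h1 : ContDiff ℝ (1 + 1) stepProfile := contDiff_stepProfile (n := 2)
    exact h1.deriv'
  have hk1 : ∀ r ≤ 1, deriv stepProfile r = 0 := fun r hr => deriv_stepProfile_of_le hr
  have h1 := h.contDiff_comp_div_smul hk hk1 hs hAC
  have hAs : HasCompactSupport A := by
    refine hws.mono fun x hx hw0 => hx ?_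
    simp [hA, hw0]
  have h2 := integral_traceCLM_fderiv_eq_zero h1 hAs.smul_left
  have hS : IsOpen {x | ρ x < 0} := isOpen_lt h.continuous continuous_const
  have h3 : ∀ x, traceCLM E (fderiv ℝ (fun x => deriv stepProfile (-ρ x / s) • A x) x) =
      deriv stepProfile (-ρ x / s) * q x := by
    intro x
    by_cases hx : ρ x < 0
    · have hwd : DifferentiableAt ℝ w x :=
        (hw.contDiffAt (hS.mem_nhds hx)).differentiableAt (by norm_num)
      have hAd : DifferentiableAt ℝ A x :=
        (hAC.contDiffAt (hS.mem_nhds hx)).differentiableAt (by norm_num)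
      rw [(h.hasFDerivAt_comp_div_smul hk hAd).fderiv, map_add, map_smul, traceCLM_smulRight]
      have hperp : fderiv ℝ ρ x (A x) = 0 := by
        rw [← inner_gradient_left, ← norm_gradient_smul_unitGradient (h.gradient_ne_zero x), hA]
        simp only [inner_smul_left, inner_smul_right, inner_sub_right]
        rw [← hn, real_inner_self_eq_norm_sq, hn, norm_unitGradient (h.gradient_ne_zero x),
          real_inner_comm (w x)]
        ring
      have hdA : traceCLM E (fderiv ℝ A x) = q x := by
        have hnd : HasFDerivAt n (fderiv ℝ n x) x :=
          (hnC.differentiable (by norm_num) x).hasFDerivAt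
        have hrd : HasFDerivAt (fun x => ‖gradient ρ x‖) (fderiv ℝ (fun x => ‖gradient ρ x‖) x) x :=
          (hrC.differentiable (by norm_num) x).hasFDerivAt
        have hwd' : HasFDerivAt w (Dw x) x := by
          rw [← hDw x hx]; exact hwd.hasFDerivAt
        have hi := hwd'.inner ℝ hnd
        have hAf : HasFDerivAt A _ x := hrd.smul (hwd'.sub (hi.smul hnd))
        -- In `div A`, the derivative of `‖∇ρ‖` along the tangential part of `w` cancels the term
        -- `‖∇ρ‖ ⟪w, Dn n⟫` coming from differentiating `⟪w, n⟫`. What remains is `q`.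
        have hkey := norm_gradient_mul_inner_fderiv_unitGradient h.contDiff.contDiffAt
          (h.gradient_ne_zero x) (w x)
        rw [← hn, real_inner_comm (w x) (n x)] at hkey
        rw [hAf.fderiv]
        simp only [map_add, map_sub, map_smul, traceCLM_smulRight, smul_eq_mul,
          ContinuousLinearMap.comp_apply, ContinuousLinearMap.prod_apply,
          fderivInnerCLM_apply, hq] at hkey ⊢
        rw [real_inner_comm (fderiv ℝ n x (n x)) (w x)]
        linarith
      rw [hdA]
      simp [hperp]
    · have hx : 0 ≤ ρ x := not_lt.1 hx
      have hev : (fun x => deriv stepProfile (-ρ x / s) • A x) =ᶠ[𝓝 x] fun _ => 0 := by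
        have h2 : {y | -s < ρ y} ∈ 𝓝 x :=
          (isOpen_lt continuous_const h.continuous).mem_nhds (by
            simp only [mem_ofPred_eq]; linarith)
        filter_upwards [h2] with y hy
        rw [hk1, zero_smul]
        rw [div_le_one hs]
        linarith [show -s < ρ y from hy]
      rw [hev.fderiv_eq, hk1]
      · simp
      · exact (div_nonpos_of_nonpos_of_nonneg (by linarith) hs.le).trans zero_le_one
  simp_rw [h3] at h2
  simp_rw [mul_assoc]
  rw [integral_const_mul, h2, mul_zero]

end IsGraphFunction
end

noncomputable section

/-! ### Local graph representation by the implicit function theorem. -/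

section LocalGraph

/-- Multiplication by a bump function supported where `f` is still of class Cⁿ. -/
theorem ContDiffAt.exists_contDiff_eventuallyEq {E F : Type*} [NormedAddCommGroup E]
    [InnerProductSpace ℝ E] [FiniteDimensional ℝ E] [NormedAddCommGroup F] [NormedSpace ℝ F]
    {n : ℕ} {f : E → F} {x : E} (h : ContDiffAt ℝ n f x) :
    ∃ g : E → F, ContDiff ℝ n g ∧ g =ᶠ[𝓝 x] f := by
  obtain ⟨R, hR, hball⟩ := Metric.eventually_nhds_iff_ball.1 (h.eventually (by simp))
  let b : ContDiffBump x := ⟨R / 3, R / 2, by positivity, by linarith⟩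
  refine ⟨fun y => b y • f y, contDiff_iff_contDiffAt.2 fun y => ?_, ?_⟩
  · by_cases hy : y ∈ Metric.ball x R
    · exact b.contDiff.contDiffAt.smul (hball y hy)
    · have hy' : y ∉ tsupport b := by
        rw [b.tsupport_eq]
        intro h'
        exact hy (Metric.closedBall_subset_ball (show R / 2 < R by linarith) h')
      have : (fun y => b y • f y) =ᶠ[𝓝 y] fun _ => 0 := by
        filter_upwards [notMem_tsupport_iff_eventuallyEq.1 hy'] with z hz
        rw [hz, Pi.zero_apply, zero_smul]
      exact contDiffAt_const.congr_of_eventuallyEq this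
  · filter_upwards [b.eventuallyEq_one] with y hy
    rw [hy, Pi.one_apply, one_smul]

variable {E : Type*} [NormedAddCommGroup E] [InnerProductSpace ℝ E] [FiniteDimensional ℝ E]

/-- Near a zero with nonzero gradient, the sublevel set of a `C²` function is a `C²` subgraph. -/
theorem exists_isGraphFunction {φ : E → ℝ} {p : E} (hφ : ContDiffAt ℝ 2 φ p)
    (hg : gradient φ p ≠ 0) (hp : φ p = 0) :
    ∃ e ρ, IsGraphFunction e ρ ∧ ∀ᶠ x in 𝓝 p, (φ x < 0 ↔ ρ x < 0) := by
  set e := unitGradient φ p with he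
  have hen : ‖e‖ = 1 := norm_unitGradient hg
  have hce : ∀ᶠ x in 𝓝 p, 0 < fderiv ℝ φ x e := by
    have hpos : 0 < fderiv ℝ φ p e := by
      rw [← inner_gradient_left, ← norm_gradient_smul_unitGradient hg, ← he, real_inner_smul_left,
        real_inner_self_eq_norm_sq, hen]
      have := norm_pos_iff.2 hg
      positivity
    have hc : ContinuousAt (fun x => fderiv ℝ φ x e) p :=
      ((hφ.fderiv_right (m := 1) (by norm_num)).continuousAt).clm_apply continuousAt_const
    exact hc.eventually (lt_mem_nhds hpos)
  -- Coordinates centred at `p` with `e` as vertical axis. The vertical derivative of `φ` is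
  -- nonzero, so `φ = 0` can be solved for the height as a function on `F`.
  let F := (ℝ ∙ e)ᗮ
  let ι : F × ℝ → E := fun v => p + (v.1 : E) + v.2 • e
  have hι : ContDiff ℝ 2 ι :=
    (contDiff_const.add (F.subtypeL.contDiff.comp contDiff_fst)).add
      (contDiff_snd.smul contDiff_const)
  have hι0 : ι (0, 0) = p := by simp [ι]
  have hf : ContDiffAt ℝ 2 (φ ∘ ι) (0, 0) := ContDiffAt.comp _ (by rwa [hι0]) hι.contDiffAt
  have hinv : (fderiv ℝ (φ ∘ ι) (0, 0) ∘L .inr ℝ F ℝ).IsInvertible := by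
    have hc : fderiv ℝ φ p e ≠ 0 := hce.self_of_nhds.ne'
    refine ⟨(LinearEquiv.smulOfNeZero ℝ ℝ _ hc).toContinuousLinearEquiv, ?_⟩
    ext
    have h1 : HasFDerivAt φ (fderiv ℝ φ p) (ι (0, 0)) := by
      rw [hι0]; exact (hφ.differentiableAt (by norm_num)).hasFDerivAt
    have h2 : HasFDerivAt ι (fderiv ℝ ι (0, 0)) (0, 0) :=
      (hι.differentiable (by norm_num) _).hasFDerivAt
    have h3 : fderiv ℝ ι (0, 0) (0, 1) = e := by
      have h4 : HasFDerivAt ι ((F.subtypeL.comp (ContinuousLinearMap.fst ℝ F ℝ)) +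
          (ContinuousLinearMap.snd ℝ F ℝ).smulRight e) (0, 0) := by
        have h5 : HasFDerivAt (fun v : F × ℝ => (v.1 : E)) _ (0, 0) :=
          (F.subtypeL.comp (ContinuousLinearMap.fst ℝ F ℝ)).hasFDerivAt
        exact (h5.const_add p).add ((ContinuousLinearMap.snd ℝ F ℝ).hasFDerivAt.smul_const e)
      rw [h4.fderiv]
      simp
    rw [(h1.comp _ h2).fderiv]
    simp [h3]
  set ψ := hf.implicitFunction (by norm_num) hinv with hψ
  have hψ0 : ψ 0 = 0 := hf.implicitFunction_apply_self (by norm_num) hinv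
  have hψz : ∀ᶠ y in 𝓝 (0 : F), φ (ι (y, ψ y)) = 0 := by
    have := hf.eventually_apply_implicitFunction (by norm_num) hinv
    simpa [hι0, hp] using this
  have hψC : ContDiffAt ℝ 2 ψ 0 := hf.contDiffAt_implicitFunction (by norm_num) hinv
  obtain ⟨g, hgC, hgψ⟩ := ContDiffAt.exists_contDiff_eventuallyEq (n := 2) hψC
  set π : E → F := fun x => F.orthogonalProjectionOnto (x - p)
  have hπ : ContDiff ℝ 2 π := F.orthogonalProjectionOnto.contDiff.comp (by fun_prop)
  have hπp : π p = 0 := by simp [π]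
  have hdecomp : ∀ x, ι (π x, inner ℝ e (x - p)) = x := by
    intro x
    have : (π x : E) = (x - p) - inner ℝ e (x - p) • e := by
      rw [← Submodule.starProjection_apply, Submodule.starProjection_orthogonal_val,
        Submodule.starProjection_unit_singleton ℝ hen]
    simp only [ι, this]
    module
  refine ⟨e, fun x => inner ℝ e (x - p) - g (π x), ⟨hen, ?_, ?_⟩, ?_⟩
  · exact (contDiff_const.inner ℝ (by fun_prop)).sub (hgC.comp hπ)
  · intro x t
    have h1 : π (x + t • e) = π x := by
      simp only [π, add_sub_right_comm, map_add, map_smul, F,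
        Submodule.orthogonalProjectionOnto_orthogonalComplement_singleton_eq_zero, smul_zero,
        add_zero]
    rw [h1, add_sub_right_comm, inner_add_right, real_inner_smul_right, real_inner_self_eq_norm_sq,
      hen]
    ring
  · have hdiff : ∀ᶠ x in 𝓝 p, DifferentiableAt ℝ φ x :=
      (hφ.eventually (by simp)).mono fun x hx => hx.differentiableAt (by norm_num)
    obtain ⟨r, hr, hball⟩ := Metric.eventually_nhds_iff_ball.1 (hce.and hdiff)
    have hπt : Tendsto π (𝓝 p) (𝓝 0) := by
      have := hπ.continuous.tendsto p
      rwa [hπp] at this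
    have h1 : ∀ᶠ x in 𝓝 p, ι (π x, g (π x)) ∈ Metric.ball p r := by
      have hc : Continuous fun x => ι (π x, g (π x)) :=
        hι.continuous.comp (hπ.continuous.prodMk (hgC.continuous.comp hπ.continuous))
      refine (hc.tendsto p).eventually (Metric.isOpen_ball.mem_nhds ?_)
      rw [hπp, hgψ.self_of_nhds, hψ0, hι0]
      exact Metric.mem_ball_self hr
    filter_upwards [h1, Metric.ball_mem_nhds p hr, hπt.eventually hψz, hπt.eventually hgψ]
      with x hx1 hx2 hx3 hx4
    set y := π x
    rw [← hx4] at hx3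
    -- `φ` increases along `e` on the ball, so its sign at `x` tells on which side of the zero on
    -- the same vertical line `x` lies.
    have hmono : StrictMonoOn (fun t => φ (ι (y, t))) {t | ι (y, t) ∈ Metric.ball p r} := by
      have hda : ∀ t, HasDerivAt (fun t => ι (y, t)) e t := by
        intro t
        have := ((hasDerivAt_id t).smul_const e).const_add (p + (y : E))
        rwa [one_smul] at this
      have hd : ∀ t ∈ {t | ι (y, t) ∈ Metric.ball p r},
          HasDerivAt (fun t => φ (ι (y, t))) (fderiv ℝ φ (ι (y, t)) e) t := fun t ht =>
        ((hball _ ht).2.hasFDerivAt).comp_hasDerivAt t (hda t)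
      refine strictMonoOn_of_deriv_pos ?_ (fun t ht => (hd t ht).continuousAt.continuousWithinAt) ?_
      · intro a ha b hb c d hc hd hcd
        have : ι (y, c • a + d • b) = c • ι (y, a) + d • ι (y, b) := by
          have h5 : c = 1 - d := by linarith
          subst h5
          simp only [ι, smul_eq_mul]
          module
        simp only [mem_ofPred_eq] at *
        rw [this]
        exact convex_ball p r ha hb hc hd hcd
      · intro t ht
        have ht := interior_subset ht
        rw [(hd t ht).deriv]
        exact (hball _ ht).1
    have h2 := hmono.lt_iff_lt (a := inner ℝ e (x - p)) (b := g y)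
      (by simpa [y, hdecomp] using hx2) hx1
    rw [sub_neg, ← h2]
    simp only [y, hdecomp] at hx3 ⊢
    rw [hx3]

end LocalGraph
end

noncomputable section

/-! ### Charts of a domain, and transfer of the integral theorems to them. -/

section GraphChart

open Module

theorem setIntegral_inter_eq_of_forall_notMem {α : Type*} [MeasurableSpace α] {μ : Measure α}
    {f : α → ℝ} {s t : Set α} (hs : MeasurableSet s) (hf : ∀ x ∉ t, f x = 0) :
    ∫ x in s ∩ t, f x ∂μ = ∫ x in s, f x ∂μ :=
  (setIntegral_eq_of_subset_of_forall_sdiff_eq_zero hs inter_subset_left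
    fun x hx => hf x fun hxt => hx.2 ⟨hx.1, hxt⟩).symm

variable {E : Type*} [NormedAddCommGroup E] [InnerProductSpace ℝ E]

/-- On the open set `U`, the set `Ω` is the subgraph `{ρ < 0}` of a `C²` graph function. -/
structure IsGraphChart (Ω U : Set E) (e : E) (ρ : E → ℝ) : Prop extends IsGraphFunction e ρ where
  isOpen : IsOpen U
  mem_iff : ∀ x ∈ U, x ∈ Ω ↔ ρ x < 0

namespace IsGraphChart

variable {Ω U : Set E} {e : E} {ρ : E → ℝ}

theorem mem_closure_iff (h : IsGraphChart Ω U e ρ) {x : E} (hx : x ∈ U) :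
    x ∈ closure Ω ↔ ρ x ≤ 0 := by
  constructor
  · intro hxc
    by_contra! hpos
    have h1 : {y | 0 < ρ y} ∈ 𝓝 x := (isOpen_lt continuous_const h.continuous).mem_nhds hpos
    obtain ⟨y, hyΩ, hyU, hy⟩ := ((mem_closure_iff_frequently.1 hxc).and_eventually
      ((h.isOpen.eventually_mem hx).and h1)).exists
    exact lt_asymm hy ((h.mem_iff y hyU).1 hyΩ)
  · intro hle
    -- Moving by `-t e` lowers `ρ` by `t`, so a point with `ρ x ≤ 0` is a limit of points of `Ω`.
    have hc : Tendsto (fun t : ℝ => x + (-t) • e) (𝓝[>] 0) (𝓝 x) := by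
      have : Continuous fun t : ℝ => x + (-t) • e := by fun_prop
      have := this.tendsto 0
      simp only [neg_zero, zero_smul, add_zero] at this
      exact this.mono_left nhdsWithin_le_nhds
    refine mem_closure_of_tendsto hc ?_
    filter_upwards [hc.eventually (h.isOpen.mem_nhds hx), self_mem_nhdsWithin] with t ht ht0
    have ht0 : 0 < t := ht0
    rw [h.mem_iff _ ht, h.map_add_smul]
    linarith

theorem mem_frontier_iff (h : IsGraphChart Ω U e ρ) (hΩ : IsOpen Ω) {x : E} (hx : x ∈ U) :
    x ∈ frontier Ω ↔ ρ x = 0 := by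
  rw [hΩ.frontier_eq, Set.mem_sdiff, h.mem_closure_iff hx, h.mem_iff x hx, not_lt, le_antisymm_iff]

theorem closure_eventuallyEq (h : IsGraphChart Ω U e ρ) {x : E} (hx : x ∈ U) :
    closure Ω =ᶠ[𝓝 x] {y | ρ y ≤ 0} := by
  filter_upwards [h.isOpen.mem_nhds hx] with y hy
  exact propext (h.mem_closure_iff hy)

/-- The closed domain and the closed subgraph agree near points of `U`; at all other points `f` is
locally zero. This lets localized fields be moved to the global subgraph. -/
theorem continuousOn_subgraph {G : Type*} [TopologicalSpace G] [Zero G]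
    (h : IsGraphChart Ω U e ρ) {f : E → G} (hf : ContinuousOn f (closure Ω))
    (h0 : ∀ x ∉ U, f =ᶠ[𝓝 x] 0) : ContinuousOn f {x | ρ x ≤ 0} := by
  intro x hx
  by_cases hxU : x ∈ U
  · exact ((hf x ((h.mem_closure_iff hxU).2 hx)).congr_set (h.closure_eventuallyEq hxU))
  · exact (continuousAt_const.congr (h0 x hxU).symm).continuousWithinAt

theorem contDiffOn_subgraph {G : Type*} [NormedAddCommGroup G] [NormedSpace ℝ G]
    (h : IsGraphChart Ω U e ρ) (hΩ : IsOpen Ω) {n : ℕ} {f : E → G} (hf : ContDiffOn ℝ n f Ω)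
    (h0 : ∀ x ∉ U, f =ᶠ[𝓝 x] 0) : ContDiffOn ℝ n f {x | ρ x < 0} := by
  intro x hx
  by_cases hxU : x ∈ U
  · exact (hf.contDiffAt (hΩ.mem_nhds ((h.mem_iff x hxU).2 hx))).contDiffWithinAt
  · exact (contDiffAt_const.congr_of_eventuallyEq (h0 x hxU)).contDiffWithinAt

variable [FiniteDimensional ℝ E] [MeasurableSpace E] [BorelSpace E]

theorem setIntegral_frontier (h : IsGraphChart Ω U e ρ) (hΩ : IsOpen Ω) {q : E → ℝ}
    (hq : ∀ x ∉ U, q x = 0) :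
    ∫ x in frontier Ω, q x ∂(μHE[finrank ℝ E - 1] : Measure E) =
      ∫ y, ‖gradient ρ (graphMap e ρ y)‖ * q (graphMap e ρ y) := by
  rw [← h.setIntegral_zeroSet]
  have hset : frontier Ω ∩ U = {x | ρ x = 0} ∩ U := by
    ext x
    exact and_congr_left fun hx => h.mem_frontier_iff hΩ hx
  rw [← setIntegral_inter_eq_of_forall_notMem isClosed_frontier.measurableSet hq, hset,
    setIntegral_inter_eq_of_forall_notMem
      (isClosed_eq h.continuous continuous_const).measurableSet hq]

theorem setIntegral_divergence (h : IsGraphChart Ω U e ρ) (hΩ : IsOpen Ω) {W ν : E → E}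
    (hW : ContDiffOn ℝ 1 W Ω) (hWc : ContinuousOn W (closure Ω)) (hWs : HasCompactSupport W)
    (h0 : ∀ x ∉ U, W =ᶠ[𝓝 x] 0)
    (hint : IntegrableOn (fun x => traceCLM E (fderiv ℝ W x)) Ω)
    (hν : ∀ x ∈ frontier Ω ∩ U, ν x = unitGradient ρ x) :
    ∫ x in Ω, traceCLM E (fderiv ℝ W x) =
      ∫ x in frontier Ω, inner ℝ (W x) (ν x) ∂(μHE[finrank ℝ E - 1] : Measure E) := by
  have hdiv0 : ∀ x ∉ U, traceCLM E (fderiv ℝ W x) = 0 := by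
    intro x hx
    rw [(h0 x hx).fderiv_eq]
    simp
  have hset : Ω ∩ U = {x | ρ x < 0} ∩ U := by
    ext x
    exact and_congr_left fun hx => h.mem_iff x hx
  have hS : IsOpen {x | ρ x < 0} := isOpen_lt h.continuous continuous_const
  have hintS : IntegrableOn (fun x => traceCLM E (fderiv ℝ W x)) {x | ρ x < 0} := by
    have h1 : IntegrableOn (fun x => traceCLM E (fderiv ℝ W x)) ({x | ρ x < 0} ∩ U) := by
      rw [← hset]
      exact hint.mono_set inter_subset_left
    exact h1.of_forall_sdiff_eq_zero hS.measurableSet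
      fun x hx => hdiv0 x fun hxU => hx.2 ⟨hx.1, hxU⟩
  rw [h.setIntegral_frontier hΩ (fun x hx => by
      rw [(h0 x hx).self_of_nhds, Pi.zero_apply, inner_zero_left]),
    ← setIntegral_inter_eq_of_forall_notMem hΩ.measurableSet hdiv0, hset,
    setIntegral_inter_eq_of_forall_notMem hS.measurableSet hdiv0,
    h.toIsGraphFunction.setIntegral_divergence (h.contDiffOn_subgraph hΩ (n := 1) hW h0)
      (h.continuousOn_subgraph hWc h0) hWs hintS]
  refine integral_congr_ae (Eventually.of_forall fun y => ?_)
  set x := graphMap e ρ y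
  by_cases hx : x ∈ U
  · simp only
    rw [hν x ⟨(h.mem_frontier_iff hΩ hx).2 (h.apply_graphMap y), hx⟩, ← real_inner_smul_right,
      norm_gradient_smul_unitGradient (h.gradient_ne_zero x), real_inner_comm, inner_gradient_left]
  · have e1 : W (graphMap e ρ y) = 0 := (h0 x hx).self_of_nhds
    simp [e1]

theorem setIntegral_surfaceDivergence (h : IsGraphChart Ω U e ρ) (hΩ : IsOpen Ω) {w ν : E → E}
    {κ : E → ℝ} {Dw : E → E →L[ℝ] E}
    (hw : ContDiffOn ℝ 1 w Ω) (hwc : ContinuousOn w (closure Ω)) (hws : HasCompactSupport w)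
    (hDw : ∀ x ∈ Ω, fderiv ℝ w x = Dw x) (hDwc : ContinuousOn Dw (closure Ω))
    (hDws : HasCompactSupport Dw)
    (h0 : ∀ x ∉ U, w =ᶠ[𝓝 x] 0) (h0' : ∀ x ∉ U, Dw =ᶠ[𝓝 x] 0)
    (hν : ∀ x ∈ frontier Ω ∩ U, ν x = unitGradient ρ x)
    (hκ : ∀ x ∈ frontier Ω ∩ U, κ x = traceCLM E (fderiv ℝ (unitGradient ρ) x)) :
    ∫ x in frontier Ω, (traceCLM E (Dw x) - inner ℝ (Dw x (ν x)) (ν x) -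
      κ x * inner ℝ (w x) (ν x)) ∂(μHE[finrank ℝ E - 1] : Measure E) = 0 := by
  have h1 := h.integral_surfaceDivergence (h.contDiffOn_subgraph hΩ (n := 1) hw h0)
      (h.continuousOn_subgraph hwc h0) (Dw := Dw) (fun x hx => ?_) (h.continuousOn_subgraph hDwc h0')
      hws (hws.isCompact.union hDws.isCompact)
      (fun x hx => image_eq_zero_of_notMem_tsupport fun h' => hx (Or.inl h'))
      (fun x hx => image_eq_zero_of_notMem_tsupport fun h' => hx (Or.inr h'))
  · rw [h.setIntegral_frontier hΩ, ← h1]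
    · refine integral_congr_ae (Eventually.of_forall fun y => ?_)
      set x := graphMap e ρ y
      by_cases hx : x ∈ U
      · have hxf : x ∈ frontier Ω ∩ U := ⟨(h.mem_frontier_iff hΩ hx).2 (h.apply_graphMap y), hx⟩
        simp only
        rw [hν x hxf, hκ x hxf]
      · have e1 : w (graphMap e ρ y) = 0 := (h0 x hx).self_of_nhds
        have e2 : Dw (graphMap e ρ y) = 0 := (h0' x hx).self_of_nhds
        simp [e1, e2]
    · intro x hx
      simp [(h0 x hx).self_of_nhds, (h0' x hx).self_of_nhds]
  · by_cases hxU : x ∈ U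
    · exact hDw x ((h.mem_iff x hxU).2 hx)
    · rw [(h0 x hxU).fderiv_eq, (h0' x hxU).self_of_nhds]
      simp

/-- The part of the graph in a closed ball lies over the compact projection of that ball, on which
the area density is bounded. -/
theorem exists_measure_frontier_inter_lt_top (h : IsGraphChart Ω U e ρ) (hΩ : IsOpen Ω) {p : E}
    (hp : p ∈ U) : ∃ t ∈ 𝓝 p, (μHE[finrank ℝ E - 1] : Measure E) (frontier Ω ∩ t) < ⊤ := by
  obtain ⟨r, hr, hrU⟩ := Metric.nhds_basis_closedBall.mem_iff.1 (h.isOpen.mem_nhds hp)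
  refine ⟨Metric.closedBall p r, Metric.closedBall_mem_nhds p hr, ?_⟩
  have h1 : frontier Ω ∩ Metric.closedBall p r ⊆ {x | ρ x = 0} ∩ Metric.closedBall p r :=
    fun x hx => ⟨(h.mem_frontier_iff hΩ (hrU hx.2)).1 hx.1, hx.2⟩
  refine (measure_mono h1).trans_lt ?_
  rw [inter_comm, ← Measure.restrict_apply Metric.isClosed_closedBall.measurableSet,
    h.restrict_zeroSet_eq_map, h.measurableEmbedding_graphMap.map_apply]
  set K := (fun x => (ℝ ∙ e)ᗮ.orthogonalProjectionOnto x) '' Metric.closedBall p r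
  have hK : IsCompact K := (isCompact_closedBall p r).image (by fun_prop)
  have hsub : graphMap e ρ ⁻¹' Metric.closedBall p r ⊆ K := by
    intro y hy
    refine ⟨_, hy, ?_⟩
    simp [graphMap, Submodule.orthogonalProjectionOnto_orthogonalComplement_singleton_eq_zero]
  refine (measure_mono hsub).trans_lt ?_
  rw [withDensity_apply _ hK.measurableSet]
  have hc : Continuous fun y => ‖gradient ρ (graphMap e ρ y)‖ :=
    (h.continuous_gradient.comp h.contDiff_graphMap.continuous).norm
  have := (hc.continuousOn.integrableOn_compact (μ := volume) hK).lintegral_lt_top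
  exact this

end IsGraphChart

end GraphChart
end

noncomputable section

/-! ### Partition of unity and finiteness of the surface measure. -/

section Global

open Module
open scoped Manifold ContDiff

theorem eventuallyEq_zero_of_notMem {X F : Type*} [TopologicalSpace X] [Zero F] {χ : X → F}
    {U : Set X} (h : tsupport χ ⊆ U) : ∀ x ∉ U, χ =ᶠ[𝓝 x] 0 := fun _ hx =>
  notMem_tsupport_iff_eventuallyEq.1 fun h' => hx (h h')

variable {E : Type*} [NormedAddCommGroup E] [InnerProductSpace ℝ E] [FiniteDimensional ℝ E]

/-- A finite `C¹` partition of unity near a compact set, subordinate to a given cover. -/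
theorem IsCompact.exists_finite_partition {K : Set E} (hK : IsCompact K) {U : E → Set E}
    (hU : ∀ x, IsOpen (U x)) (hxU : ∀ x, x ∈ U x) :
    ∃ (t : Finset E) (χ : E → E → ℝ), (∀ i, ContDiff ℝ 1 (χ i)) ∧
      (∀ i, HasCompactSupport (χ i)) ∧ (∀ i, tsupport (χ i) ⊆ U i) ∧
      ∀ x ∈ K, (fun y => ∑ i ∈ t, χ i y) =ᶠ[𝓝 x] fun _ => 1 := by
  obtain ⟨f, hf⟩ := SmoothPartitionOfUnity.exists_isSubordinate 𝓘(ℝ, E) (isClosed_univ (X := E))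
    (fun i => U i ∩ Metric.ball i 1) (fun i => (hU i).inter Metric.isOpen_ball)
    (fun x _ => mem_iUnion.2 ⟨x, hxU x, Metric.mem_ball_self one_pos⟩)
  -- The functions are selected by meeting a compact set with `K` in its interior. Their sum is then
  -- 1 near every point of `K`, so its derivative vanishes there too.
  obtain ⟨K', hK', hKK'⟩ := exists_compact_superset hK
  have hfin := f.locallyFinite.finite_nonempty_inter_compact hK'
  refine ⟨hfin.toFinset, fun i => f i, fun i => ?_, fun i => ?_, fun i => ?_, fun x hx => ?_⟩
  · exact (f i).contMDiff.contDiff.of_le (by exact_mod_cast le_top)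
  · exact (isCompact_closedBall i 1).of_isClosed_subset (isClosed_tsupport _)
      ((hf i).trans (inter_subset_right.trans Metric.ball_subset_closedBall))
  · exact (hf i).trans inter_subset_left
  · filter_upwards [isOpen_interior.mem_nhds (hKK' hx)] with y hy
    rw [← f.sum_eq_one (mem_univ y), finsum_eq_sum_of_support_subset]
    intro i hi
    simp only [Finite.coe_toFinset, mem_ofPred_eq]
    exact ⟨y, hi, interior_subset hy⟩

/-- The boundary of `Ω` is covered by `C²` graph charts, with outer unit normal `ν` and sum of
principal curvatures `κ`. -/
def HasGraphCharts (Ω : Set E) (ν : E → E) (κ : E → ℝ) : Prop :=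
  ∀ p ∈ frontier Ω, ∃ U e ρ, p ∈ U ∧ IsGraphChart Ω U e ρ ∧ ∀ x ∈ frontier Ω ∩ U,
    ν x = unitGradient ρ x ∧ κ x = traceCLM E (fderiv ℝ (unitGradient ρ) x)

namespace HasGraphCharts

variable {Ω : Set E} {ν : E → E} {κ : E → ℝ}

theorem continuousOn_normal (h : HasGraphCharts Ω ν κ) : ContinuousOn ν (frontier Ω) := by
  intro p hp
  obtain ⟨U, e, ρ, hpU, hc, hν⟩ := h p hp
  refine (hc.contDiff_unitGradient.continuous.continuousWithinAt).congr_of_eventuallyEq_of_mem ?_ hp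
  filter_upwards [self_mem_nhdsWithin, mem_nhdsWithin_of_mem_nhds (hc.isOpen.mem_nhds hpU)]
    with x hx hxU
  exact (hν x ⟨hx, hxU⟩).1

theorem continuousOn_curvature (h : HasGraphCharts Ω ν κ) : ContinuousOn κ (frontier Ω) := by
  intro p hp
  obtain ⟨U, e, ρ, hpU, hc, hν⟩ := h p hp
  have h1 : Continuous fun x => traceCLM E (fderiv ℝ (unitGradient ρ) x) :=
    (traceCLM E).continuous.comp (hc.contDiff_unitGradient.continuous_fderiv (by norm_num))
  refine h1.continuousWithinAt.congr_of_eventuallyEq_of_mem ?_ hp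
  filter_upwards [self_mem_nhdsWithin, mem_nhdsWithin_of_mem_nhds (hc.isOpen.mem_nhds hpU)]
    with x hx hxU
  exact (hν x ⟨hx, hxU⟩).2

/-- Cover by charts at boundary points and by the complement of the boundary elsewhere. Each
function then falls under the divergence theorem in a chart or under the one for fields vanishing
near the boundary. -/
theorem exists_partition (h : HasGraphCharts Ω ν κ) (hb : Bornology.IsBounded Ω) :
    ∃ (t : Finset E) (χ : E → E → ℝ), (∀ i, ContDiff ℝ 1 (χ i)) ∧
      (∀ i, HasCompactSupport (χ i)) ∧ (∀ i, tsupport (χ i) ⊆ (frontier Ω)ᶜ ∨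
        ∃ U e ρ, tsupport (χ i) ⊆ U ∧ IsGraphChart Ω U e ρ ∧ ∀ x ∈ frontier Ω ∩ U,
          ν x = unitGradient ρ x ∧ κ x = traceCLM E (fderiv ℝ (unitGradient ρ) x)) ∧
      ∀ x ∈ closure Ω, (fun y => ∑ i ∈ t, χ i y) =ᶠ[𝓝 x] fun _ => 1 := by
  choose! U e ρ hpU hc hν using h
  classical
  obtain ⟨t, χ, h1, h2, h3, h4⟩ := hb.isCompact_closure.exists_finite_partition
    (U := fun x => if x ∈ frontier Ω then U x else (frontier Ω)ᶜ)
    (fun x => by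
      split_ifs with hx
      · exact (hc x hx).isOpen
      · exact isClosed_frontier.isOpen_compl)
    (fun x => by
      split_ifs with hx
      · exact hpU x hx
      · exact hx)
  refine ⟨t, χ, h1, h2, fun i => ?_, h4⟩
  have h5 := h3 i
  split_ifs at h5 with hi
  · exact Or.inr ⟨U i, e i, ρ i, h5, hc i hi, hν i hi⟩
  · exact Or.inl h5

variable [MeasurableSpace E] [BorelSpace E]

theorem measure_frontier_lt_top (h : HasGraphCharts Ω ν κ) (hΩ : IsOpen Ω)
    (hb : Bornology.IsBounded Ω) : (μHE[finrank ℝ E - 1] : Measure E) (frontier Ω) < ⊤ := by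
  have hK : IsCompact (frontier Ω) :=
    hb.isCompact_closure.of_isClosed_subset isClosed_frontier frontier_subset_closure
  refine hK.measure_lt_top_of_nhdsWithin fun p hp => ?_
  obtain ⟨U, e, ρ, hpU, hc, -⟩ := h p hp
  obtain ⟨t, ht, hlt⟩ := hc.exists_measure_frontier_inter_lt_top hΩ hpU
  exact ⟨frontier Ω ∩ t, inter_mem self_mem_nhdsWithin (mem_nhdsWithin_of_mem_nhds ht), hlt⟩

theorem integrableOn_frontier (h : HasGraphCharts Ω ν κ) (hΩ : IsOpen Ω)
    (hb : Bornology.IsBounded Ω) {f : E → ℝ} (hf : ContinuousOn f (frontier Ω)) :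
    IntegrableOn f (frontier Ω) (μHE[finrank ℝ E - 1] : Measure E) := by
  have hK : IsCompact (frontier Ω) :=
    hb.isCompact_closure.of_isClosed_subset isClosed_frontier frontier_subset_closure
  obtain ⟨C, hC⟩ := hK.exists_bound_of_continuousOn hf
  refine IntegrableOn.of_bound (h.measure_frontier_lt_top hΩ hb)
    (hf.aestronglyMeasurable hK.measurableSet) C ?_
  exact (ae_restrict_mem hK.measurableSet).mono hC

end HasGraphCharts

end Global
end

noncomputable section

/-! ### Divergence theorem and surface divergence theorem on a bounded domain. -/

section Global

open Module

variable {E : Type*} [NormedAddCommGroup E] [InnerProductSpace ℝ E] [FiniteDimensional ℝ E]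
  [MeasurableSpace E] [BorelSpace E]

/-- Cut to zero outside `Ω`, the field is C¹ with compact support on the whole space. -/
theorem setIntegral_divergence_eq_zero {Ω : Set E} (hΩ : IsOpen Ω) {W : E → E}
    (hW : ContDiffOn ℝ 1 W Ω) (hWs : HasCompactSupport W)
    (h0 : ∀ x ∈ frontier Ω, W =ᶠ[𝓝 x] 0) :
    ∫ x in Ω, traceCLM E (fderiv ℝ W x) = 0 := by
  classical
  set W' : E → E := Ω.indicator W with hW'
  have hin : ∀ x ∈ Ω, W' =ᶠ[𝓝 x] W := fun x hx => by
    filter_upwards [hΩ.mem_nhds hx] with y hy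
    exact indicator_of_mem hy _
  have hout : ∀ x ∉ Ω, W' =ᶠ[𝓝 x] 0 := fun x hx => by
    by_cases hxc : x ∈ closure Ω
    · filter_upwards [h0 x (by rw [hΩ.frontier_eq]; exact ⟨hxc, hx⟩)] with y hy
      by_cases hyΩ : y ∈ Ω <;> simp [hW', hyΩ, hy]
    · filter_upwards [isClosed_closure.isOpen_compl.mem_nhds hxc] with y hy
      exact indicator_of_notMem (fun h => hy (subset_closure h)) _
  have hC : ContDiff ℝ 1 W' := contDiff_iff_contDiffAt.2 fun x => by
    by_cases hx : x ∈ Ω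
    · exact (hW.contDiffAt (hΩ.mem_nhds hx)).congr_of_eventuallyEq (hin x hx)
    · exact contDiffAt_const.congr_of_eventuallyEq (hout x hx)
  have hs : HasCompactSupport W' := hWs.mono (by
    rw [hW', support_indicator]; exact inter_subset_right)
  have h1 : ∫ x in Ω, traceCLM E (fderiv ℝ W' x) = ∫ x, traceCLM E (fderiv ℝ W' x) :=
    setIntegral_eq_integral_of_forall_compl_eq_zero fun x hx => by
      rw [(hout x hx).fderiv_eq]
      simp
  rw [← integral_traceCLM_fderiv_eq_zero hC hs, ← h1]
  exact setIntegral_congr_fun hΩ.measurableSet fun x hx => by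
    simp only [(hin x hx).fderiv_eq]

namespace HasGraphCharts

variable {Ω : Set E} {ν : E → E} {κ : E → ℝ}

/-- **Divergence theorem** on a bounded `C²` domain, for a field which is `C¹` inside, continuous
up to the boundary and with integrable divergence. -/
theorem setIntegral_divergence (h : HasGraphCharts Ω ν κ) (hΩ : IsOpen Ω)
    (hb : Bornology.IsBounded Ω) {V : E → E} (hV : ContDiffOn ℝ 1 V Ω)
    (hVc : ContinuousOn V (closure Ω))
    (hint : IntegrableOn (fun x => traceCLM E (fderiv ℝ V x)) Ω) :
    ∫ x in Ω, traceCLM E (fderiv ℝ V x) =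
      ∫ x in frontier Ω, inner ℝ (V x) (ν x) ∂(μHE[finrank ℝ E - 1] : Measure E) := by
  obtain ⟨t, χ, hχ, hχs, hχU, hsum⟩ := h.exists_partition hb
  have hVd : ∀ x ∈ Ω, DifferentiableAt ℝ V x := fun x hx =>
    (hV.contDiffAt (hΩ.mem_nhds hx)).differentiableAt (by norm_num)
  have hχd : ∀ i x, DifferentiableAt ℝ (χ i) x := fun i x => (hχ i).differentiable (by norm_num) x
  have hfd : ∀ i, ∀ x ∈ Ω, traceCLM E (fderiv ℝ (fun x => χ i x • V x) x) =
      χ i x * traceCLM E (fderiv ℝ V x) + fderiv ℝ (χ i) x (V x) := by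
    intro i x hx
    rw [fderiv_fun_smul (hχd i x) (hVd x hx), map_add, map_smul, traceCLM_smulRight, smul_eq_mul]
  have hinti : ∀ i, IntegrableOn (fun x => traceCLM E (fderiv ℝ (fun x => χ i x • V x) x)) Ω := by
    intro i
    have hχc := (hχ i).continuous
    obtain ⟨C, hC⟩ := (hχs i).exists_bound_of_continuous hχc
    have h1 : IntegrableOn (fun x => χ i x * traceCLM E (fderiv ℝ V x)) Ω :=
      Integrable.bdd_mul hint hχc.aestronglyMeasurable (Eventually.of_forall hC)
    have h2 : IntegrableOn (fun x => fderiv ℝ (χ i) x (V x)) Ω :=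
      ((((hχ i).continuous_fderiv (by norm_num)).continuousOn.clm_apply hVc).integrableOn_compact
        hb.isCompact_closure).mono_set subset_closure
    exact (h1.add h2).congr_fun (fun x hx => (hfd i x hx).symm) hΩ.measurableSet
  have hbdry : ∀ i, ∫ x in Ω, traceCLM E (fderiv ℝ (fun x => χ i x • V x) x) =
      ∫ x in frontier Ω, χ i x * inner ℝ (V x) (ν x) ∂(μHE[finrank ℝ E - 1] : Measure E) := by
    intro i
    have hW : ContDiffOn ℝ 1 (fun x => χ i x • V x) Ω := (hχ i).contDiffOn.smul hV
    have hWs : HasCompactSupport (fun x => χ i x • V x) := (hχs i).smul_right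
    have hz : ∀ x, χ i =ᶠ[𝓝 x] 0 → (fun x => χ i x • V x) =ᶠ[𝓝 x] 0 := fun x hx => by
      filter_upwards [hx] with y hy
      rw [hy]
      simp
    rcases hχU i with hi | ⟨U, e, ρ, hi, hc, hν⟩
    · have hi0 := eventuallyEq_zero_of_notMem hi
      rw [setIntegral_divergence_eq_zero hΩ hW hWs fun x hx => hz x (hi0 x fun h' => h' hx)]
      symm
      refine setIntegral_eq_zero_of_forall_eq_zero fun x hx => ?_
      rw [(hi0 x fun h' => h' hx).self_of_nhds]
      simp
    · have hi0 := eventuallyEq_zero_of_notMem hi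
      rw [hc.setIntegral_divergence hΩ hW ((hχ i).continuous.continuousOn.smul hVc) hWs
        (fun x hx => hz x (hi0 x hx)) (hinti i) (fun x hx => (hν x hx).1)]
      simp_rw [real_inner_smul_left]
  have hL : ∫ x in Ω, traceCLM E (fderiv ℝ V x) =
      ∫ x in Ω, ∑ i ∈ t, traceCLM E (fderiv ℝ (fun x => χ i x • V x) x) := by
    refine setIntegral_congr_fun hΩ.measurableSet fun x hx => ?_
    have hev : V =ᶠ[𝓝 x] fun y => ∑ i ∈ t, χ i y • V y := by
      filter_upwards [hsum x (subset_closure hx)] with y hy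
      rw [← Finset.sum_smul, hy, one_smul]
    rw [hev.fderiv_eq, fderiv_fun_sum (A := fun i y => χ i y • V y) fun i _ => (hχd i x).smul (hVd x hx),
      map_sum]
  have hR : ∫ x in frontier Ω, inner ℝ (V x) (ν x) ∂(μHE[finrank ℝ E - 1] : Measure E) =
      ∫ x in frontier Ω, ∑ i ∈ t, χ i x * inner ℝ (V x) (ν x)
        ∂(μHE[finrank ℝ E - 1] : Measure E) := by
    refine setIntegral_congr_fun isClosed_frontier.measurableSet fun x hx => ?_
    have h1 : ∑ i ∈ t, χ i x = 1 := (hsum x (frontier_subset_closure hx)).self_of_nhds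
    rw [← Finset.sum_mul, h1, one_mul]
  rw [hL, hR, integral_finsetSum _ fun i _ => hinti i, integral_finsetSum _ fun i _ => ?_]
  · exact Finset.sum_congr rfl fun i _ => hbdry i
  · exact h.integrableOn_frontier hΩ hb ((hχ i).continuous.continuousOn.mul
      ((hVc.mono frontier_subset_closure).inner h.continuousOn_normal))

/-- **Surface divergence theorem** on the boundary of a bounded `C²` domain, for a field of class
`C¹` up to the boundary. -/
theorem setIntegral_surfaceDivergence (h : HasGraphCharts Ω ν κ) (hΩ : IsOpen Ω)
    (hb : Bornology.IsBounded Ω) {w : E → E} {Dw : E → E →L[ℝ] E} (hw : ContDiffOn ℝ 1 w Ω)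
    (hwc : ContinuousOn w (closure Ω)) (hDw : ∀ x ∈ Ω, fderiv ℝ w x = Dw x)
    (hDwc : ContinuousOn Dw (closure Ω)) :
    ∫ x in frontier Ω, (traceCLM E (Dw x) - inner ℝ (Dw x (ν x)) (ν x) -
      κ x * inner ℝ (w x) (ν x)) ∂(μHE[finrank ℝ E - 1] : Measure E) = 0 := by
  obtain ⟨t, χ, hχ, hχs, hχU, hsum⟩ := h.exists_partition hb
  have hχd : ∀ i x, DifferentiableAt ℝ (χ i) x := fun i x => (hχ i).differentiable (by norm_num) x
  have hχD : ∀ i, Continuous (fderiv ℝ (χ i)) := fun i => (hχ i).continuous_fderiv (by norm_num)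
  -- The product-rule derivative of `χ i • w`, written with `Dw` so that it has continuous values up
  -- to the boundary.
  set D : E → E → E →L[ℝ] E := fun i x => χ i x • Dw x + (fderiv ℝ (χ i) x).smulRight (w x) with hD
  have hDc : ∀ i, ContinuousOn (D i) (closure Ω) := fun i =>
    ((hχ i).continuous.continuousOn.smul hDwc).add
      (((ContinuousLinearMap.smulRightL ℝ E E).continuous.comp (hχD i)).continuousOn.clm_apply hwc)
  have hfr : frontier Ω ⊆ closure Ω := frontier_subset_closure
  set Q : (E → E →L[ℝ] E) → (E → E) → E → ℝ := fun A v x =>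
    traceCLM E (A x) - inner ℝ (A x (ν x)) (ν x) - κ x * inner ℝ (v x) (ν x) with hQ
  have hQc : ∀ i, ContinuousOn (Q (D i) (fun x => χ i x • w x)) (frontier Ω) := by
    intro i
    have h1 := (hDc i).mono hfr
    have h2 := (hwc.mono hfr)
    have h3 := h.continuousOn_normal
    exact (((traceCLM E).continuous.comp_continuousOn h1).sub ((h1.clm_apply h3).inner h3)).sub
      (h.continuousOn_curvature.mul (((hχ i).continuous.continuousOn.smul h2).inner h3))
  have hQi : ∀ i, ∫ x in frontier Ω, Q (D i) (fun x => χ i x • w x) x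
      ∂(μHE[finrank ℝ E - 1] : Measure E) = 0 := by
    intro i
    have hz : ∀ x, χ i =ᶠ[𝓝 x] 0 → (fun x => χ i x • w x) =ᶠ[𝓝 x] 0 ∧ D i =ᶠ[𝓝 x] 0 := by
      intro x hx
      constructor
      · filter_upwards [hx] with y hy
        rw [hy]
        simp
      · filter_upwards [hx.eventuallyEq_nhds] with y hy
        simp only [hD]
        rw [hy.fderiv_eq, hy.self_of_nhds]
        ext v
        simp
    rcases hχU i with hi | ⟨U, e, ρ, hi, hc, hν⟩
    · have hi0 := eventuallyEq_zero_of_notMem hi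
      refine setIntegral_eq_zero_of_forall_eq_zero fun x hx => ?_
      obtain ⟨h1, h2⟩ := hz x (hi0 x fun h' => h' hx)
      simp only [hQ]
      rw [h2.self_of_nhds, show χ i x • w x = 0 from h1.self_of_nhds]
      simp
    · have hi0 := eventuallyEq_zero_of_notMem hi
      refine hc.setIntegral_surfaceDivergence hΩ (w := fun x => χ i x • w x) (Dw := D i)
        ((hχ i).contDiffOn.smul hw)
        ((hχ i).continuous.continuousOn.smul hwc) (hχs i).smul_right ?_ (hDc i) ?_
        (fun x hx => (hz x (hi0 x hx)).1) (fun x hx => (hz x (hi0 x hx)).2)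
        (fun x hx => (hν x hx).1) (fun x hx => (hν x hx).2)
      · intro x hx
        rw [fderiv_fun_smul (hχd i x)
          ((hw.contDiffAt (hΩ.mem_nhds hx)).differentiableAt (by norm_num)), hDw x hx]
      · refine HasCompactSupport.intro' (hχs i).isCompact (isClosed_tsupport _) fun x hx => ?_
        exact (hz x (notMem_tsupport_iff_eventuallyEq.1 hx)).2.self_of_nhds
  have hsumQ : ∀ x ∈ frontier Ω, Q Dw w x = ∑ i ∈ t, Q (D i) (fun x => χ i x • w x) x := by
    intro x hx
    have h1 := hsum x (hfr hx)
    have h2 : ∑ i ∈ t, χ i x = 1 := h1.self_of_nhds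
    -- The sum is constant near `x`, so the gradient corrections in the `D i` add up to zero.
    have h3 : ∑ i ∈ t, fderiv ℝ (χ i) x = 0 := by
      rw [← fderiv_fun_sum fun i _ => hχd i x, h1.fderiv_eq]
      simp
    have h4 : ∑ i ∈ t, D i x = Dw x := by
      simp only [hD, Finset.sum_add_distrib, ← Finset.sum_smul, h2, one_smul]
      have : ∑ i ∈ t, (fderiv ℝ (χ i) x).smulRight (w x) =
          (∑ i ∈ t, fderiv ℝ (χ i) x).smulRight (w x) := by
        ext v
        simp [Finset.sum_smul]
      rw [this, h3]
      ext v
      simp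
    have h5 : ∑ i ∈ t, χ i x • w x = w x := by rw [← Finset.sum_smul, h2, one_smul]
    simp only [hQ, Finset.sum_sub_distrib, ← map_sum, ← sum_inner, ← Finset.mul_sum, h4, h5,
      ← sum_apply]
  rw [setIntegral_congr_fun isClosed_frontier.measurableSet hsumQ,
    integral_finsetSum _ fun i _ => h.integrableOn_frontier hΩ hb (hQc i)]
  exact Finset.sum_eq_zero fun i _ => hQi i

end HasGraphCharts

end Global
end

noncomputable section

/-! ### Tangent directions at boundary points. -/

namespace IsGraphChart

variable {E : Type*} [NormedAddCommGroup E] [InnerProductSpace ℝ E] {Ω U : Set E} {e : E}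
  {ρ : E → ℝ}

/-- Each `v` with `Dρ v < 0` points into the domain, and this open half-space spans. In the span
argument, adding a suitable multiple of `-e` brings any vector into the half-space. -/
theorem uniqueDiffWithinAt_closure (h : IsGraphChart Ω U e ρ) (hΩ : IsOpen Ω) {x : E}
    (hxU : x ∈ U) (hx : x ∈ frontier Ω) : UniqueDiffWithinAt ℝ (closure Ω) x := by
  have hρx : ρ x = 0 := (h.mem_frontier_iff hΩ hxU).1 hx
  have hcone : ∀ v, fderiv ℝ ρ x v < 0 → v ∈ tangentConeAt ℝ (closure Ω) x := by
    intro v hv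
    have hd := (h.differentiable x).hasFDerivAt.hasLineDerivAt v
    have hs := (hasDerivAt_iff_tendsto_slope.1 hd).eventually (gt_mem_nhds hv)
    have le : 𝓝[>] (0:ℝ) ≤ 𝓝[≠] 0 := nhdsWithin_mono _ fun t ht => ne_of_gt ht
    refine mem_tangentConeAt_of_add_smul_mem (l := 𝓝[>] (0:ℝ)) (c := id) le ?_
    have hc : Tendsto (fun t : ℝ => x + t • v) (𝓝[>] 0) (𝓝 x) := by
      have : Continuous fun t : ℝ => x + t • v := by fun_prop
      have := this.tendsto 0
      simp only [zero_smul, add_zero] at this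
      exact this.mono_left nhdsWithin_le_nhds
    filter_upwards [hs.filter_mono le, hc.eventually (h.isOpen.mem_nhds hxU), self_mem_nhdsWithin]
      with t ht1 ht2 ht3
    have ht3 : 0 < t := ht3
    refine (h.mem_closure_iff ht2).2 ?_
    simp only [slope_def_field, zero_smul, add_zero, hρx, sub_zero] at ht1
    rcases div_neg_iff.1 ht1 with h' | h' <;> linarith [h'.1, h'.2]
  refine ⟨?_, subset_closure (frontier_subset_closure hx)⟩
  have htop : Submodule.span ℝ (tangentConeAt ℝ (closure Ω) x) = ⊤ := by
    rw [eq_top_iff]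
    intro v _
    have he : -e ∈ tangentConeAt ℝ (closure Ω) x := hcone _ (by rw [map_neg, h.fderiv_self]; simp)
    have hv : v + (fderiv ℝ ρ x v + 1) • -e ∈ tangentConeAt ℝ (closure Ω) x := hcone _ (by
      rw [map_add, map_smul, map_neg, h.fderiv_self, smul_eq_mul]
      linarith)
    have := Submodule.sub_mem _ (Submodule.subset_span hv)
      (Submodule.smul_mem _ (fderiv ℝ ρ x v + 1) (Submodule.subset_span he))
    simpa using this
  rw [htop]
  exact dense_univ

/-- Every tangent vector is the velocity of a curve in the boundary. -/
theorem exists_curve (h : IsGraphChart Ω U e ρ) (hΩ : IsOpen Ω) {x τ : E}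
    (hxU : x ∈ U) (hx : x ∈ frontier Ω) (hτ : fderiv ℝ ρ x τ = 0) :
    ∃ γ : ℝ → E, γ 0 = x ∧ HasDerivAt γ τ 0 ∧ ∀ᶠ t in 𝓝 0, γ t ∈ frontier Ω := by
  have hρx : ρ x = 0 := (h.mem_frontier_iff hΩ hxU).1 hx
  -- The straight line corrected along `e` back to the graph. The correction is of first order zero
  -- because `Dρ τ = 0`.
  set γ : ℝ → E := fun t => x + t • τ + (-ρ (x + t • τ)) • e
  have hγ0 : γ 0 = x := by simp [γ, hρx]
  have hline : HasDerivAt (fun t : ℝ => x + t • τ) τ 0 := by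
    simpa using ((hasDerivAt_id (0:ℝ)).smul_const τ).const_add x
  have hρl : HasDerivAt (fun t : ℝ => ρ (x + t • τ)) 0 0 := by
    have := (h.differentiable x).hasFDerivAt.hasLineDerivAt τ
    rwa [hτ] at this
  have hγ : HasDerivAt γ τ 0 := by
    have := hline.add (hρl.neg.smul_const e)
    rw [neg_zero, zero_smul, add_zero] at this
    exact this
  refine ⟨γ, hγ0, hγ, ?_⟩
  have hU : ∀ᶠ t in 𝓝 0, γ t ∈ U :=
    hγ.continuousAt.eventually (h.isOpen.mem_nhds (by rwa [hγ0]))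
  filter_upwards [hU] with t ht
  rw [h.mem_frontier_iff hΩ ht, h.map_add_smul]
  ring

end IsGraphChart

/-- A derivative within a hypersurface is determined only on tangent vectors. Curves in the set give
a comparison there without uniqueness of the whole derivative. -/
theorem HasFDerivWithinAt.apply_eq_of_curve {E F : Type*} [NormedAddCommGroup E] [NormedSpace ℝ E]
    [NormedAddCommGroup F] [NormedSpace ℝ F] {f g : E → F} {f' g' : E →L[ℝ] F} {s : Set E} {x τ : E}
    (hf : HasFDerivWithinAt f f' s x) (hg : HasFDerivWithinAt g g' s x) {γ : ℝ → E} (hγ0 : γ 0 = x)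
    (hγ : HasDerivAt γ τ 0) (hγs : ∀ᶠ t in 𝓝 0, γ t ∈ s)
    (hfg : ∀ᶠ t in 𝓝 0, f (γ t) = g (γ t)) : f' τ = g' τ := by
  have h1 := hf.comp_hasDerivAt_of_eq 0 hγ hγs hγ0.symm
  have h2 := hg.comp_hasDerivAt_of_eq 0 hγ hγs hγ0.symm
  exact h1.unique (h2.congr_of_eventuallyEq hfg)

/-! ### Normal, shape operator and mean curvature in a chart. -/

namespace RobinTorsion

variable {N : ℕ} {Ω U : Set (EuclideanSpace ℝ (Fin N))}
  {e x : EuclideanSpace ℝ (Fin N)} {ρ : EuclideanSpace ℝ (Fin N) → ℝ}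

theorem HasC2Boundary.exists_isGraphChart (h : HasC2Boundary Ω) (hΩ : IsOpen Ω) (hx : x ∈ frontier Ω) :
    ∃ U e ρ, x ∈ U ∧ IsGraphChart Ω U e ρ := by
  obtain ⟨φ, hφ⟩ := h x hx
  obtain ⟨e, ρ, hρ, hev⟩ :=
    exists_isGraphFunction hφ.contDiffAt hφ.gradient_ne_zero (hφ.eq_zero hx hΩ)
  obtain ⟨U, hU, hUo, hxU⟩ := eventually_nhds_iff.1 (hφ.eventually_mem_iff.and hev)
  exact ⟨U, e, ρ, hxU, hρ, hUo, fun y hy => (hU y hy).1.trans (hU y hy).2⟩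

theorem outerNormal_eq_unitGradient (h : IsGraphChart Ω U e ρ) (hΩ : IsOpen Ω) (hxU : x ∈ U)
    (hx : x ∈ frontier Ω) : outerNormal Ω x = unitGradient ρ x := by
  have hn : IsOuterUnitNormal Ω x (unitGradient ρ x) :=
    ⟨ρ, ⟨h.contDiff.contDiffAt, h.gradient_ne_zero x, by
      filter_upwards [h.isOpen.mem_nhds hxU] with y hy using h.mem_iff y hy⟩, rfl⟩
  have hex : x ∈ frontier Ω ∧ ∃ n, IsOuterUnitNormal Ω x n := ⟨hx, _, hn⟩
  rw [outerNormal, dif_pos hex]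
  exact isOuterUnitNormal_unique hΩ hx hex.2.choose_spec hn

theorem outerNormal_eventuallyEq (h : IsGraphChart Ω U e ρ) (hΩ : IsOpen Ω) (hxU : x ∈ U) :
    outerNormal Ω =ᶠ[𝓝[frontier Ω] x] unitGradient ρ := by
  filter_upwards [self_mem_nhdsWithin, mem_nhdsWithin_of_mem_nhds (h.isOpen.mem_nhds hxU)]
    with y hy hyU using outerNormal_eq_unitGradient h hΩ hyU hy

theorem hasFDerivWithinAt_outerNormal (h : IsGraphChart Ω U e ρ) (hΩ : IsOpen Ω) (hxU : x ∈ U)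
    (hx : x ∈ frontier Ω) :
    HasFDerivWithinAt (outerNormal Ω) (fderiv ℝ (unitGradient ρ) x) (frontier Ω) x :=
  ((h.contDiff_unitGradient.differentiable (by norm_num) x).hasFDerivAt.hasFDerivWithinAt
    ).congr_of_eventuallyEq (outerNormal_eventuallyEq h hΩ hxU)
    (outerNormal_eq_unitGradient h hΩ hxU hx)

theorem fderiv_apply_eq_zero_iff (h : IsGraphChart Ω U e ρ) {τ : EuclideanSpace ℝ (Fin N)} :
    fderiv ℝ ρ x τ = 0 ↔ inner ℝ (unitGradient ρ x) τ = 0 := by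
  rw [← inner_gradient_left, ← norm_gradient_smul_unitGradient (h.gradient_ne_zero x),
    real_inner_smul_left]
  simp [h.gradient_ne_zero x]

/-- On the projected, hence tangent, vector the chosen derivative within the boundary must agree
with the derivative of the extension `unitGradient ρ`. -/
theorem gradNormal_apply (h : IsGraphChart Ω U e ρ) (hΩ : IsOpen Ω) (hxU : x ∈ U)
    (hx : x ∈ frontier Ω) (v : EuclideanSpace ℝ (Fin N)) :
    gradNormal Ω x v = fderiv ℝ (unitGradient ρ) x
      (v - inner ℝ (unitGradient ρ x) v • unitGradient ρ x) := by
  have hn := norm_unitGradient (h.gradient_ne_zero x)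
  have hproj : (tangentPlane Ω x).starProjection v =
      v - inner ℝ (unitGradient ρ x) v • unitGradient ρ x := by
    rw [tangentPlane, Submodule.starProjection_orthogonal_val,
      Submodule.starProjection_unit_singleton ℝ (by rw [outerNormal_eq_unitGradient h hΩ hxU hx, hn]),
      outerNormal_eq_unitGradient h hΩ hxU hx]
  rw [gradNormal, ContinuousLinearMap.comp_apply, hproj]
  set τ := v - inner ℝ (unitGradient ρ x) v • unitGradient ρ x
  have hτ : fderiv ℝ ρ x τ = 0 := by
    rw [fderiv_apply_eq_zero_iff h, inner_sub_right, real_inner_smul_right,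
      real_inner_self_eq_norm_sq, hn]
    ring
  obtain ⟨γ, hγ0, hγ, hγs⟩ := h.exists_curve hΩ hxU hx hτ
  have hd := hasFDerivWithinAt_outerNormal h hΩ hxU hx
  exact hd.differentiableWithinAt.hasFDerivWithinAt.apply_eq_of_curve hd hγ0 hγ hγs
    (Eventually.of_forall fun _ => rfl)

/-- The two maps differ by the rank-one map `v ↦ ⟪n, v⟫ Dn n`. Its trace `⟪n, Dn n⟫` vanishes
because `n` has constant length. -/
theorem traceCLM_gradNormal (h : IsGraphChart Ω U e ρ) (hΩ : IsOpen Ω) (hxU : x ∈ U)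
    (hx : x ∈ frontier Ω) :
    traceCLM _ (gradNormal Ω x) = traceCLM _ (fderiv ℝ (unitGradient ρ) x) := by
  have h1 : gradNormal Ω x = fderiv ℝ (unitGradient ρ) x -
      (innerSL ℝ (unitGradient ρ x)).smulRight
        (fderiv ℝ (unitGradient ρ) x (unitGradient ρ x)) := by
    ext1 v
    rw [gradNormal_apply h hΩ hxU hx]
    simp
  rw [h1, map_sub, traceCLM_smulRight, innerSL_apply_apply, real_inner_comm,
    inner_fderiv_unitGradient_self h.contDiff.contDiffAt (h.gradient_ne_zero x), sub_zero]

theorem inner_gradNormal_outerNormal (h : IsGraphChart Ω U e ρ) (hΩ : IsOpen Ω) (hxU : x ∈ U)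
    (hx : x ∈ frontier Ω) (v : EuclideanSpace ℝ (Fin N)) :
    inner ℝ (gradNormal Ω x v) (outerNormal Ω x) = 0 := by
  rw [gradNormal_apply h hΩ hxU hx, outerNormal_eq_unitGradient h hΩ hxU hx,
    inner_fderiv_unitGradient_self h.contDiff.contDiffAt (h.gradient_ne_zero x)]

/-- On tangent vectors `‖∇ρ‖ ⟪Dn a, b⟫` is the Hessian of `ρ`. Symmetry makes the characteristic
polynomial split over `ℝ`, so that its real roots account for the whole trace. -/
theorem weingarten_isSymmetric (h : IsGraphChart Ω U e ρ) (hΩ : IsOpen Ω) (hxU : x ∈ U)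
    (hx : x ∈ frontier Ω) : (weingarten Ω x).IsSymmetric := by
  have htan : ∀ a : tangentPlane Ω x, inner ℝ (unitGradient ρ x) (a : EuclideanSpace ℝ (Fin N)) = 0 := by
    intro a
    rw [← outerNormal_eq_unitGradient h hΩ hxU hx]
    exact Submodule.mem_orthogonal_singleton_iff_inner_right.1 a.2
  have hr := h.norm_gradient_pos x
  have hD : ∀ a b : tangentPlane Ω x, ‖gradient ρ x‖ * inner ℝ (fderiv ℝ (unitGradient ρ) x a)
      (b : EuclideanSpace ℝ (Fin N)) = inner ℝ (fderiv ℝ (gradient ρ) x a)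
      (b : EuclideanSpace ℝ (Fin N)) := by
    intro a b
    rw [fderiv_gradient_apply_eq h.contDiff.contDiffAt (h.gradient_ne_zero x), inner_add_left,
      real_inner_smul_left, real_inner_smul_left, htan b]
    ring
  have hW : ∀ a b : tangentPlane Ω x, inner ℝ (weingarten Ω x a) b =
      inner ℝ (fderiv ℝ (unitGradient ρ) x a) (b : EuclideanSpace ℝ (Fin N)) := by
    intro a b
    have : weingarten Ω x a = (tangentPlane Ω x).orthogonalProjectionOnto (gradNormal Ω x a) := rfl
    rw [this, Submodule.inner_orthogonalProjectionOnto_eq_of_mem_right, gradNormal_apply h hΩ hxU hx,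
      htan a, zero_smul, sub_zero]
  intro a b
  rw [hW, real_inner_comm (weingarten Ω x b) a, hW]
  refine mul_left_cancel₀ hr.ne' ?_
  rw [hD, hD, inner_fderiv_gradient_comm h.contDiff.contDiffAt, real_inner_comm]

/-- The sum of the roots is the trace of the shape operator. By cyclicity this is the trace of
`gradNormal` on the whole space, since `gradNormal` already factors through the tangent projection.
-/
theorem meanCurvature_eq (h : IsGraphChart Ω U e ρ) (hΩ : IsOpen Ω) (hxU : x ∈ U)
    (hx : x ∈ frontier Ω) (hN : 2 ≤ N) :
    ((N : ℝ) - 1) * meanCurvature Ω x = traceCLM _ (gradNormal Ω x) := by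
  have hN' : (N : ℝ) - 1 ≠ 0 := by
    have : (2:ℝ) ≤ N := by exact_mod_cast hN
    linarith
  have h1 : (principalCurvatures Ω x).sum = LinearMap.trace ℝ _ (weingarten Ω x) :=
    (Module.End.trace_eq_sum_roots_charpoly_of_splits
      (weingarten_isSymmetric h hΩ hxU hx).splits_charpoly).symm
  rw [meanCurvature, h1, ← mul_assoc, mul_one_div_cancel hN', one_mul, traceCLM_apply]
  set P := tangentPlane Ω x
  have h2 : weingarten Ω x = P.orthogonalProjectionOnto.toLinearMap ∘ₗ
      ((gradNormal Ω x).toLinearMap ∘ₗ P.subtype) := rfl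
  have h3 : (gradNormal Ω x).toLinearMap =
      ((gradNormal Ω x).toLinearMap ∘ₗ P.subtype) ∘ₗ P.orthogonalProjectionOnto.toLinearMap := by
    ext1 v
    have : P.starProjection (P.starProjection v) = P.starProjection v :=
      Submodule.starProjection_eq_self_iff.2 (Submodule.starProjection_apply_mem _ _)
    change gradNormal Ω x v = gradNormal Ω x (P.starProjection v)
    simp only [gradNormal, ContinuousLinearMap.comp_apply]
    rw [this]
  rw [h2, LinearMap.trace_comp_comm', ← h3]

theorem HasC2Boundary.hasGraphCharts (h : HasC2Boundary Ω) (hΩ : IsOpen Ω) :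
    HasGraphCharts Ω (outerNormal Ω) (fun x => traceCLM _ (gradNormal Ω x)) := by
  intro p hp
  obtain ⟨U, e, ρ, hpU, hc⟩ := h.exists_isGraphChart hΩ hp
  exact ⟨U, e, ρ, hpU, hc, fun x hx => ⟨outerNormal_eq_unitGradient hc hΩ hx.2 hx.1,
    traceCLM_gradNormal hc hΩ hx.2 hx.1⟩⟩

/-- Derivatives within the closed domain are then unique, which gives `grad` and `hessian` their
regularity up to the boundary. -/
theorem HasC2Boundary.uniqueDiffOn_closure (h : HasC2Boundary Ω) (hΩ : IsOpen Ω) :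
    UniqueDiffOn ℝ (closure Ω) := by
  intro x hx
  by_cases hxΩ : x ∈ Ω
  · exact uniqueDiffWithinAt_of_mem_nhds (mem_of_superset (hΩ.mem_nhds hxΩ) subset_closure)
  · have hxf : x ∈ frontier Ω := by rw [hΩ.frontier_eq]; exact ⟨hx, hxΩ⟩
    obtain ⟨U, e, ρ, hpU, hc⟩ := h.exists_isGraphChart hΩ hxf
    exact hc.uniqueDiffWithinAt_closure hΩ hpU hxf

theorem HasC2Boundary.continuousOn_gradNormal_apply (h : HasC2Boundary Ω) (hΩ : IsOpen Ω)
    {f : EuclideanSpace ℝ (Fin N) → EuclideanSpace ℝ (Fin N)} (hf : ContinuousOn f (frontier Ω)) :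
    ContinuousOn (fun x => gradNormal Ω x (f x)) (frontier Ω) := by
  intro p hp
  obtain ⟨U, e, ρ, hpU, hc⟩ := h.exists_isGraphChart hΩ hp
  have hn := hc.contDiff_unitGradient.continuous.continuousOn (s := frontier Ω)
  have hD := (hc.contDiff_unitGradient.continuous_fderiv (by norm_num)).continuousOn
    (s := frontier Ω)
  refine ContinuousWithinAt.congr_of_eventuallyEq_of_mem
    ((hD.clm_apply (hf.sub ((ContinuousOn.inner (𝕜 := ℝ) hn hf).smul hn))) p hp) ?_ hp
  filter_upwards [self_mem_nhdsWithin, mem_nhdsWithin_of_mem_nhds (hc.isOpen.mem_nhds hpU)]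
    with x hx hxU using gradNormal_apply hc hΩ hxU hx _

end RobinTorsion
end

noncomputable section

/-! ### Interior smoothness for a constant Laplacian. -/

section Poisson

open scoped ContDiff

variable {E : Type*} [NormedAddCommGroup E] [InnerProductSpace ℝ E] [FiniteDimensional ℝ E]

theorem laplacian_eq_traceCLM_fderiv_gradient {f : E → ℝ} {x : E} (h : ContDiffAt ℝ 2 f x) :
    (Δ f) x = traceCLM E (fderiv ℝ (gradient f) x) := by
  rw [laplacian_eq_iteratedFDeriv_stdOrthonormalBasis, traceCLM_eq_sum_inner (stdOrthonormalBasis ℝ E)]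
  refine Finset.sum_congr rfl fun i _ => ?_
  rw [iteratedFDeriv_two_apply, real_inner_comm, inner_fderiv_gradient_left h]
  rfl

/-- By symmetry of third derivatives, this trace is the derivative of the Laplacian in direction
`w`. -/
theorem traceCLM_fderiv_fderiv_apply {f : E → ℝ} {x : E} (h : ContDiffAt ℝ 3 f x) {c : ℝ}
    (hc : ∀ᶠ y in 𝓝 x, (Δ f) y = c) (w : E) :
    traceCLM E ((fderiv ℝ (fderiv ℝ (gradient f)) x).flip w) = 0 := by
  have h2 : ContDiffAt ℝ 2 (gradient f) x := h.gradient (by norm_num)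
  have hd : DifferentiableAt ℝ (fderiv ℝ (gradient f)) x :=
    (h2.fderiv_right (m := 1) (by norm_num)).differentiableAt (by norm_num)
  have hsymm : (fderiv ℝ (fderiv ℝ (gradient f)) x).flip w = fderiv ℝ (fderiv ℝ (gradient f)) x w := by
    ext1 v
    exact (h2.isSymmSndFDerivAt (by simp)).eq v w
  have h3 : (fun y => traceCLM E (fderiv ℝ (gradient f) y)) =ᶠ[𝓝 x] fun _ => c := by
    filter_upwards [hc, (h.of_le (by norm_num) : ContDiffAt ℝ 2 f x).eventually (by simp)]
      with y hy hy2
    rw [← laplacian_eq_traceCLM_fderiv_gradient hy2, hy]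
  have h4 : HasFDerivAt (fun y => traceCLM E (fderiv ℝ (gradient f) y))
      ((traceCLM E).comp (fderiv ℝ (fderiv ℝ (gradient f)) x)) x :=
    (traceCLM E).hasFDerivAt.comp x hd.hasFDerivAt
  have h5 := h4.unique ((hasFDerivAt_const c x).congr_of_eventuallyEq h3)
  rw [hsymm]
  exact DFunLike.congr_fun h5 w

variable (E) in
/-- A smooth compactly supported radial kernel `η` with nonzero integral such that `y η(y)` is the
gradient of a compactly supported function. -/
theorem exists_radial_kernel [Nontrivial E] [MeasurableSpace E] [BorelSpace E] {r : ℝ}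
    (hr : 0 < r) : ∃ ζ η : E → ℝ, ContDiff ℝ ∞ ζ ∧ ContDiff ℝ ∞ η ∧ (∀ y, r ≤ ‖y‖ → ζ y = 0) ∧
      (∀ y, r ≤ ‖y‖ → η y = 0) ∧ (∀ y, HasFDerivAt ζ (η y • innerSL ℝ y) y) ∧
      ∫ y, η y ≠ 0 := by
  set F : ℝ → ℝ := fun s => Real.smoothTransition (1 - s / r ^ 2)
  have hF : ContDiff ℝ ∞ F := Real.smoothTransition.contDiff.comp (by fun_prop)
  have hFd : ∀ s, HasDerivAt F (deriv F s) s := fun s =>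
    (hF.differentiable (by simp) s).hasDerivAt
  have hdF : ContDiff ℝ ∞ (deriv F) := (contDiff_infty_iff_deriv.1 hF).2
  have hF0 : ∀ s, r ^ 2 ≤ s → F s = 0 := fun s hs =>
    Real.smoothTransition.zero_of_nonpos (by
      rw [sub_nonpos, le_div_iff₀ (by positivity)]
      linarith)
  have hdF0 : ∀ s, r ^ 2 ≤ s → deriv F s = 0 := fun s hs =>
    IsLocalMin.deriv_eq_zero (Eventually.of_forall fun t => by
      rw [hF0 s hs]
      exact Real.smoothTransition.nonneg _)
  have hanti : Antitone F := fun s t hst => Real.smoothTransition.monotone (by gcongr)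
  have hsq : ContDiff ℝ ∞ fun y : E => ‖y‖ ^ 2 := contDiff_norm_sq ℝ
  have hle : ∀ y : E, r ≤ ‖y‖ → r ^ 2 ≤ ‖y‖ ^ 2 := fun y hy => by gcongr
  refine ⟨fun y => F (‖y‖ ^ 2), fun y => 2 * deriv F (‖y‖ ^ 2), hF.comp hsq,
    contDiff_const.mul (hdF.comp hsq), fun y hy => hF0 _ (hle y hy), fun y hy => ?_, fun y => ?_, ?_⟩
  · simp only [hdF0 _ (hle y hy), mul_zero]
  · have := (hFd (‖y‖ ^ 2)).comp_hasFDerivAt y (hasStrictFDerivAt_norm_sq y).hasFDerivAt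
    refine this.congr_fderiv ?_
    ext v
    simp
    ring
  -- `F` falls from 1 to 0 on `[0, r²]`, so the mean value theorem gives a point with `F' ≠ 0`.
  -- Since `F' ≤ 0` everywhere, the integral of the kernel cannot cancel.
  · obtain ⟨s, ⟨hs0, -⟩, hs⟩ := exists_deriv_eq_slope F (show (0:ℝ) < r ^ 2 by positivity)
      hF.continuous.continuousOn (hF.differentiable (by simp)).differentiableOn
    obtain ⟨y, hy⟩ := exists_norm_eq E (Real.sqrt_nonneg s)
    have hy2 : ‖y‖ ^ 2 = s := by rw [hy, Real.sq_sqrt hs0.le]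
    have hne : deriv F s ≠ 0 := by
      have h0 : F 0 = 1 := by simp [F]
      rw [hs, hF0 _ le_rfl, h0]
      simp [hr.ne']
    have hc : Continuous fun y : E => -(2 * deriv F (‖y‖ ^ 2)) :=
      (continuous_const.mul (hdF.continuous.comp hsq.continuous)).neg
    have hpos := hc.integral_pos_of_hasCompactSupport_nonneg_nonzero (μ := volume) (x := y)
      (HasCompactSupport.of_support_subset_isCompact (isCompact_closedBall (0:E) r) fun z hz => by
        rw [mem_closedBall_zero_iff]
        by_contra! hlt
        exact hz (by simp only [hdF0 _ (hle z hlt.le), mul_zero, neg_zero]))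
      (fun z => by
        have := hanti.deriv_nonpos (x := ‖z‖ ^ 2)
        simp only [Pi.zero_apply]
        linarith) (by simpa [hy2] using hne)
    rw [integral_neg] at hpos
    linarith

/-- A mean value argument. Let `I(t) = ∫ η(y) g(x - ty) dy`. As `η(y) y = ∇ζ(y)`, integration by
parts gives `I'(t) = -t c ∫ ζ`. Integrating from 0 to 1 expresses `g(x) ∫ η` as `(η * g)(x)` plus a
constant, and the convolution is smooth. -/
theorem contDiffAt_infty_of_laplacian_eq_const [Nontrivial E] [MeasurableSpace E]
    [BorelSpace E] {f : E → ℝ} {p : E} {c : ℝ} (hf : ContDiffAt ℝ 2 f p)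
    (hc : ∀ᶠ y in 𝓝 p, (Δ f) y = c) : ContDiffAt ℝ ∞ f p := by
  obtain ⟨g, hg, hgf⟩ := ContDiffAt.exists_contDiff_eventuallyEq (n := 2) hf
  have hgc : ∀ᶠ y in 𝓝 p, (Δ g) y = c := by
    filter_upwards [hc, eventually_eventually_nhds.2 hgf] with y hy hy2
    rw [(laplacian_congr_nhds hy2).self_of_nhds, hy]
  obtain ⟨R, hR, hball⟩ := Metric.eventually_nhds_iff_ball.1 hgc
  -- Both `x - p` and `t y` have length at most `r`, so `x - t y` stays in the ball where the
  -- Laplacian is `c`.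
  set r := R / 2 with hr_def
  have hr : 0 < r := by positivity
  obtain ⟨ζ, η, hζ, hη, hζ0, hη0, hζη, hI⟩ := exists_radial_kernel E hr
  have hcs : ∀ φ : E → ℝ, (∀ y, r ≤ ‖y‖ → φ y = 0) → HasCompactSupport φ := fun φ hφ =>
    HasCompactSupport.of_support_subset_isCompact (isCompact_closedBall (0:E) r) fun z hz => by
      rw [mem_closedBall_zero_iff]
      by_contra! hlt
      exact hz (hφ z hlt.le)
  have hgrad : ContDiff ℝ 1 (gradient g) :=
    contDiff_iff_contDiffAt.2 fun x => hg.contDiffAt.gradient (by norm_num)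
  have hdg := hg.continuous_fderiv (by norm_num)
  have hder : ∀ x, ∀ t : ℝ, t ∈ Icc (0:ℝ) 1 → HasDerivAt (fun t : ℝ => ∫ y, η y * g (x - t • y))
      (∫ y, -(η y * fderiv ℝ g (x - t • y) y)) t := by
    intro x t ht
    have hcC : Continuous fun q : ℝ × E => fderiv ℝ g (x - q.1 • q.2) q.2 :=
      (hdg.comp (by fun_prop : Continuous fun q : ℝ × E => x - q.1 • q.2)).clm_apply continuous_snd
    obtain ⟨C, hC⟩ := ((isCompact_Icc (a := (-1:ℝ)) (b := 2)).prod
      (isCompact_closedBall (0:E) r)).exists_bound_of_continuousOn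
      (f := fun q : ℝ × E => fderiv ℝ g (x - q.1 • q.2) q.2)
      hcC.continuousOn
    refine (hasDerivAt_integral_of_dominated_loc_of_deriv_le
      (F := fun t y => η y * g (x - t • y)) (F' := fun t y => -(η y * fderiv ℝ g (x - t • y) y))
      (bound := fun y => ‖η y‖ * C)
      -- The interval `(-1, 2)` leaves room for two-sided derivatives at both endpoints of `[0, 1]`.
      (Ioo_mem_nhds (show (-1:ℝ) < t by linarith [ht.1]) (show t < 2 by linarith [ht.2])) ?_ ?_ ?_
      (Eventually.of_forall fun y s hs => ?_) ?_ (Eventually.of_forall fun y s _ => ?_)).2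
    · exact Eventually.of_forall fun s => (hη.continuous.mul
        (hg.continuous.comp (by fun_prop))).aestronglyMeasurable
    · exact (hη.continuous.mul (hg.continuous.comp (by fun_prop))).integrable_of_hasCompactSupport
        ((hcs η hη0).mul_right)
    · exact (hη.continuous.mul
        ((hdg.comp (by fun_prop)).clm_apply continuous_id)).neg.aestronglyMeasurable
    · rw [norm_neg, norm_mul]
      by_cases hy : r ≤ ‖y‖
      · simp [hη0 y hy]
      · gcongr
        exact hC (s, y) ⟨⟨hs.1.le, hs.2.le⟩, mem_closedBall_zero_iff.2 (not_le.1 hy).le⟩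
    · exact (hη.continuous.norm.mul continuous_const).integrable_of_hasCompactSupport
        ((hcs η hη0).norm.mul_right)
    · have h1 : HasDerivAt (fun s : ℝ => x - s • y) (-y) s := by
        simpa using ((hasDerivAt_id s).smul_const y).const_sub x
      have h2 := ((hg.differentiable (by norm_num) _).hasFDerivAt.comp_hasDerivAt s h1).const_mul (η y)
      refine h2.congr_deriv ?_
      rw [map_neg, mul_neg]
  have hval : ∀ x ∈ Metric.ball p r, ∀ t ∈ Icc (0:ℝ) 1,
      ∫ y, -(η y * fderiv ℝ g (x - t • y) y) = -(t * (c * ∫ y, ζ y)) := by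
    intro x hx t ht
    set X : E → E := fun y => ζ y • gradient g (x - t • y)
    have hXc : ContDiff ℝ 1 X := (hζ.of_le (by simp)).smul (hgrad.comp (by fun_prop))
    have hXs : HasCompactSupport X := (hcs ζ hζ0).smul_right
    have hDX : ∀ y, traceCLM E (fderiv ℝ X y) =
        η y * fderiv ℝ g (x - t • y) y - t * (c * ζ y) := by
      intro y
      have h1 : HasFDerivAt (fun y => gradient g (x - t • y))
          ((fderiv ℝ (gradient g) (x - t • y)).comp (-(t • ContinuousLinearMap.id ℝ E))) y :=
        (hgrad.differentiable (by norm_num) _).hasFDerivAt.comp y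
          (((hasFDerivAt_id y).const_smul t).const_sub x)
      have h2 : HasFDerivAt X _ y := (hζη y).smul h1
      rw [h2.fderiv, map_add, map_smul, traceCLM_smulRight, ContinuousLinearMap.comp_neg,
        ContinuousLinearMap.comp_smul, ContinuousLinearMap.comp_id, map_neg, map_smul]
      have h3 : inner ℝ y (gradient g (x - t • y)) = fderiv ℝ g (x - t • y) y := by
        rw [real_inner_comm, inner_gradient_left]
      have h4 : ζ y * traceCLM E (fderiv ℝ (gradient g) (x - t • y)) = ζ y * c := by
        by_cases hy : r ≤ ‖y‖
        · simp [hζ0 y hy]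
        · rw [← laplacian_eq_traceCLM_fderiv_gradient hg.contDiffAt, hball]
          rw [Metric.mem_ball, dist_eq_norm] at hx ⊢
          have h5 : ‖t • y‖ ≤ r := by
            rw [norm_smul, Real.norm_of_nonneg ht.1]
            nlinarith [norm_nonneg y, ht.2, not_le.1 hy, ht.1]
          calc ‖x - t • y - p‖ = ‖(x - p) - t • y‖ := by congr 1; abel
            _ ≤ ‖x - p‖ + ‖t • y‖ := norm_sub_le _ _
            _ < R := by linarith
      simp only [_root_.smul_apply, smul_eq_mul, innerSL_apply_apply, h3]
      linear_combination (-t) * h4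
    have h0 := integral_traceCLM_fderiv_eq_zero hXc hXs
    simp_rw [hDX] at h0
    rw [integral_sub, integral_const_mul, integral_const_mul] at h0
    · rw [integral_neg]
      linarith
    · exact (hη.continuous.mul ((hdg.comp (by fun_prop)).clm_apply
        continuous_id)).integrable_of_hasCompactSupport ((hcs η hη0).mul_right)
    · exact ((hζ.continuous.integrable_of_hasCompactSupport (hcs ζ hζ0)).const_mul c).const_mul t
  have hconv : ∀ x ∈ Metric.ball p r, g x =
      (∫ y, η y)⁻¹ * (convolution η g (ContinuousLinearMap.mul ℝ ℝ) volume x + c * (∫ y, ζ y) / 2) := by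
    intro x hx
    have hd : ∀ t ∈ Icc (0:ℝ) 1, HasDerivAt (fun t : ℝ => (∫ y, η y * g (x - t • y)) +
        t ^ 2 / 2 * (c * ∫ y, ζ y)) 0 t := by
      intro t ht
      have h1 := hder x t ht
      rw [hval x hx t ht] at h1
      have h2 : HasDerivAt (fun t : ℝ => t ^ 2 / 2 * (c * ∫ y, ζ y)) (t * (c * ∫ y, ζ y)) t := by
        have := (((hasDerivAt_id t).pow 2).div_const 2).mul_const (c * ∫ y, ζ y)
        refine this.congr_deriv ?_
        simp
      exact (h1.add h2).congr_deriv (by ring)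
    have := constant_of_has_deriv_right_zero (a := 0) (b := 1)
      (f := fun t : ℝ => (∫ y, η y * g (x - t • y)) + t ^ 2 / 2 * (c * ∫ y, ζ y))
      (fun t ht => (hd t ht).continuousAt.continuousWithinAt)
      (fun t ht => (hd t ⟨ht.1, ht.2.le⟩).hasDerivWithinAt) 1
      (right_mem_Icc.2 zero_le_one)
    simp only [one_smul, zero_smul, sub_zero, integral_mul_const] at this
    rw [convolution_def]
    simp only [ContinuousLinearMap.mul_apply']
    field_simp
    linarith
  have hsm : ContDiff ℝ ∞ (convolution η g (ContinuousLinearMap.mul ℝ ℝ) volume) :=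
    (hcs η hη0).contDiff_convolution_left _ hη hg.continuous.locallyIntegrable
  refine ContDiffAt.congr_of_eventuallyEq
    ((contDiff_const (c := (∫ y, η y)⁻¹)).mul
      (hsm.add (contDiff_const (c := c * (∫ y, ζ y) / 2)))).contDiffAt ?_
  filter_upwards [hgf, Metric.ball_mem_nhds p hr] with x hx hx2
  rw [← hx, hconv x hx2]

end Poisson

end

noncomputable section

/-! ### Gradient and Laplacian of the P-function for a general function. -/

section PFunction

open scoped ContDiff

variable {E : Type*} [NormedAddCommGroup E] [InnerProductSpace ℝ E] [FiniteDimensional ℝ E]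

theorem gradient_half_norm_gradient_sq_sub {f : E → ℝ} {x : E} (h : ContDiffAt ℝ 2 f x) :
    gradient (fun y => 1 / 2 * ‖gradient f y‖ ^ 2 - f y) x =
      fderiv ℝ (gradient f) x (gradient f x) - gradient f x := by
  have h1 := ((h.gradient (m := 1) (by norm_num)).differentiableAt (by norm_num)).hasFDerivAt
  have h2 := (h.differentiableAt (by norm_num)).hasFDerivAt
  refine ext_inner_right ℝ fun v => ?_
  have h3 : HasFDerivAt (fun y => 1 / 2 * ‖gradient f y‖ ^ 2 - f y) _ x :=
    (h1.norm_sq.const_mul (1 / 2)).sub h2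
  rw [inner_gradient_left, h3.fderiv, inner_sub_left, inner_gradient_left,
    inner_fderiv_gradient_comm h]
  simp

/-- Of the two product-rule terms of `D²f ∇f`, the one with third derivatives is the derivative of
the constant Laplacian along `∇f`, and vanishes. -/
theorem traceCLM_fderiv_gradient_half_norm_gradient_sq_sub {f : E → ℝ} {x : E}
    (h : ContDiffAt ℝ 3 f x) {c : ℝ} (hc : ∀ᶠ y in 𝓝 x, (Δ f) y = c) :
    traceCLM E (fderiv ℝ (fun y => fderiv ℝ (gradient f) y (gradient f y) - gradient f y) x) =
      traceCLM E ((fderiv ℝ (gradient f) x).comp (fderiv ℝ (gradient f) x)) - c := by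
  have h2 : ContDiffAt ℝ 2 (gradient f) x := h.gradient (by norm_num)
  have hd1 := (h2.differentiableAt (by norm_num)).hasFDerivAt
  have hd2 := ((h2.fderiv_right (m := 1) (by norm_num)).differentiableAt (by norm_num)).hasFDerivAt
  have h3 : HasFDerivAt (fun y => fderiv ℝ (gradient f) y (gradient f y) - gradient f y) _ x :=
    (hd2.clm_apply hd1).sub hd1
  rw [h3.fderiv, map_sub, map_add, traceCLM_fderiv_fderiv_apply h hc, add_zero,
    ← laplacian_eq_traceCLM_fderiv_gradient (h.of_le (by norm_num)), hc.self_of_nhds]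

end PFunction

/-! ### Regularity of the solution and of its P-function. -/

namespace RobinTorsion

variable {N : ℕ} {Ω : Set (EuclideanSpace ℝ (Fin N))} {u : EuclideanSpace ℝ (Fin N) → ℝ}
  {x : EuclideanSpace ℝ (Fin N)}

/-- The Hessian of `u`, up to the boundary. -/
def hessian (Ω : Set (EuclideanSpace ℝ (Fin N))) (u : EuclideanSpace ℝ (Fin N) → ℝ)
    (x : EuclideanSpace ℝ (Fin N)) : EuclideanSpace ℝ (Fin N) →L[ℝ] EuclideanSpace ℝ (Fin N) :=
  fderivWithin ℝ (grad Ω u) (closure Ω) x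

theorem closure_mem_nhds (hΩ : IsOpen Ω) (hx : x ∈ Ω) : closure Ω ∈ 𝓝 x :=
  mem_of_superset (hΩ.mem_nhds hx) subset_closure

theorem grad_eq_gradient (hΩ : IsOpen Ω) (hx : x ∈ Ω) : grad Ω u x = gradient u x := by
  rw [grad, gradientWithin, fderivWithin_of_mem_nhds (closure_mem_nhds hΩ hx), gradient]

theorem grad_eventuallyEq (hΩ : IsOpen Ω) (hx : x ∈ Ω) : grad Ω u =ᶠ[𝓝 x] gradient u := by
  filter_upwards [hΩ.mem_nhds hx] with y hy using grad_eq_gradient hΩ hy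

theorem fderiv_grad_eq_hessian (hΩ : IsOpen Ω) (hx : x ∈ Ω) :
    fderiv ℝ (grad Ω u) x = hessian Ω u x := by
  rw [hessian, fderivWithin_of_mem_nhds (closure_mem_nhds hΩ hx)]

theorem hessian_eq_fderiv_gradient (hΩ : IsOpen Ω) (hx : x ∈ Ω) :
    hessian Ω u x = fderiv ℝ (gradient u) x := by
  rw [← fderiv_grad_eq_hessian hΩ hx, (grad_eventuallyEq hΩ hx).fderiv_eq]

theorem contDiffOn_grad (hΩ : IsOpen Ω) (hC2 : HasC2Boundary Ω)
    (hu : ContDiffOn ℝ 2 u (closure Ω)) : ContDiffOn ℝ 1 (grad Ω u) (closure Ω) :=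
  (toDual ℝ (EuclideanSpace ℝ (Fin N))).symm.toContinuousLinearEquiv.toContinuousLinearMap.contDiff
    |>.comp_contDiffOn (hu.fderivWithin (hC2.uniqueDiffOn_closure hΩ) (by norm_num))

theorem continuousOn_hessian (hΩ : IsOpen Ω) (hC2 : HasC2Boundary Ω)
    (hu : ContDiffOn ℝ 2 u (closure Ω)) : ContinuousOn (hessian Ω u) (closure Ω) :=
  (contDiffOn_grad hΩ hC2 hu).continuousOn_fderivWithin (hC2.uniqueDiffOn_closure hΩ) (by norm_num)

theorem hasFDerivWithinAt_grad (hΩ : IsOpen Ω) (hC2 : HasC2Boundary Ω)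
    (hu : ContDiffOn ℝ 2 u (closure Ω)) (hx : x ∈ closure Ω) :
    HasFDerivWithinAt (grad Ω u) (hessian Ω u x) (closure Ω) x :=
  ((contDiffOn_grad hΩ hC2 hu).differentiableOn (by norm_num) x hx).hasFDerivWithinAt

namespace IsRobinTorsionSolution

variable {β : ℝ}

theorem contDiffAt (h : IsRobinTorsionSolution Ω β u) (hΩ : IsOpen Ω) (hx : x ∈ Ω) :
    ContDiffAt ℝ 2 u x :=
  h.contDiffOn.contDiffAt (closure_mem_nhds hΩ hx)

theorem eventually_laplacian_eq (h : IsRobinTorsionSolution Ω β u) (hΩ : IsOpen Ω) (hx : x ∈ Ω) :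
    ∀ᶠ y in 𝓝 x, (Δ u) y = (N : ℝ) := by
  filter_upwards [hΩ.mem_nhds hx] with y hy using h.laplacian_eq y hy

theorem contDiffAt_three (h : IsRobinTorsionSolution Ω β u) (hN : 2 ≤ N) (hΩ : IsOpen Ω)
    (hx : x ∈ Ω) : ContDiffAt ℝ 3 u x := by
  have : Nonempty (Fin N) := ⟨⟨0, by omega⟩⟩
  exact (contDiffAt_infty_of_laplacian_eq_const (h.contDiffAt hΩ hx)
    (h.eventually_laplacian_eq hΩ hx)).of_le (WithTop.coe_le_coe.2 (le_top : (3 : ℕ∞) ≤ ⊤))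

/-- The equation holds in `Ω` and passes to the closure by continuity of the Hessian. Its boundary
values are needed in `surface_identity`. -/
theorem traceCLM_hessian (h : IsRobinTorsionSolution Ω β u) (hΩ : IsOpen Ω)
    (hC2 : HasC2Boundary Ω) (hx : x ∈ closure Ω) : traceCLM _ (hessian Ω u x) = N := by
  refine EqOn.of_subset_closure (s := Ω) (t := closure Ω) (fun y hy => ?_)
    ((traceCLM _).continuous.comp_continuousOn (continuousOn_hessian hΩ hC2 h.contDiffOn))
    (continuousOn_const (c := (N : ℝ))) subset_closure subset_rfl hx
  simp only [Function.comp_apply]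
  rw [hessian_eq_fderiv_gradient hΩ hy,
    ← laplacian_eq_traceCLM_fderiv_gradient (h.contDiffAt hΩ hy), h.laplacian_eq y hy]

theorem inner_hessian_comm (h : IsRobinTorsionSolution Ω β u) (hΩ : IsOpen Ω)
    (hC2 : HasC2Boundary Ω) (hx : x ∈ closure Ω) (v w : EuclideanSpace ℝ (Fin N)) :
    inner ℝ (hessian Ω u x v) w = inner ℝ v (hessian Ω u x w) := by
  have hc := continuousOn_hessian hΩ hC2 h.contDiffOn
  refine EqOn.of_subset_closure (s := Ω) (t := closure Ω)
    (f := fun y => inner ℝ (hessian Ω u y v) w) (g := fun y => inner ℝ v (hessian Ω u y w))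
    (fun y hy => ?_) ((hc.clm_apply continuousOn_const).inner (𝕜 := ℝ) continuousOn_const)
    (continuousOn_const.inner (𝕜 := ℝ) (hc.clm_apply continuousOn_const)) subset_closure subset_rfl
    hx
  simp only
  rw [hessian_eq_fderiv_gradient hΩ hy, inner_fderiv_gradient_comm (h.contDiffAt hΩ hy)]

theorem pFunction_eventuallyEq (hΩ : IsOpen Ω) (hx : x ∈ Ω) :
    pFunction Ω u =ᶠ[𝓝 x] fun y => 1 / 2 * ‖gradient u y‖ ^ 2 - u y := by
  filter_upwards [hΩ.mem_nhds hx] with y hy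
  rw [pFunction, grad_eq_gradient hΩ hy]

theorem contDiffOn_pFunction (h : IsRobinTorsionSolution Ω β u) (hN : 2 ≤ N) (hΩ : IsOpen Ω) :
    ContDiffOn ℝ 2 (pFunction Ω u) Ω := fun x hx =>
  ContDiffAt.contDiffWithinAt <| ContDiffAt.congr_of_eventuallyEq
    ((contDiffAt_const.mul (((h.contDiffAt_three hN hΩ hx).gradient (by norm_num)).norm_sq ℝ)).sub
      (h.contDiffAt hΩ hx)) (pFunction_eventuallyEq hΩ hx)

/-- The gradient field of the `P`-function. -/
def pGradient (Ω : Set (EuclideanSpace ℝ (Fin N))) (u : EuclideanSpace ℝ (Fin N) → ℝ)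
    (x : EuclideanSpace ℝ (Fin N)) : EuclideanSpace ℝ (Fin N) :=
  hessian Ω u x (grad Ω u x) - grad Ω u x

theorem pGradient_eventuallyEq (hΩ : IsOpen Ω) (hx : x ∈ Ω) :
    pGradient Ω u =ᶠ[𝓝 x] fun y => fderiv ℝ (gradient u) y (gradient u y) - gradient u y := by
  filter_upwards [hΩ.mem_nhds hx] with y hy
  rw [pGradient, grad_eq_gradient hΩ hy, hessian_eq_fderiv_gradient hΩ hy]

theorem contDiffOn_pGradient (h : IsRobinTorsionSolution Ω β u) (hN : 2 ≤ N) (hΩ : IsOpen Ω) :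
    ContDiffOn ℝ 1 (pGradient Ω u) Ω := fun x hx => by
  have h2 : ContDiffAt ℝ 2 (gradient u) x := (h.contDiffAt_three hN hΩ hx).gradient (by norm_num)
  have h1 : ContDiffAt ℝ 1 (gradient u) x := h2.of_le (by norm_num)
  exact ContDiffAt.contDiffWithinAt <| ContDiffAt.congr_of_eventuallyEq
    (((h2.fderiv_right (by norm_num)).clm_apply h1).sub h1) (pGradient_eventuallyEq hΩ hx)

theorem continuousOn_pGradient (h : IsRobinTorsionSolution Ω β u) (hΩ : IsOpen Ω)
    (hC2 : HasC2Boundary Ω) : ContinuousOn (pGradient Ω u) (closure Ω) := by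
  have hg := (contDiffOn_grad hΩ hC2 h.contDiffOn).continuousOn
  exact ((continuousOn_hessian hΩ hC2 h.contDiffOn).clm_apply hg).sub hg

theorem laplacian_pFunction_eq (h : IsRobinTorsionSolution Ω β u) (hN : 2 ≤ N) (hΩ : IsOpen Ω)
    (hx : x ∈ Ω) : (Δ (pFunction Ω u)) x = traceCLM _ (fderiv ℝ (pGradient Ω u) x) := by
  have hgrad : gradient (pFunction Ω u) =ᶠ[𝓝 x] pGradient Ω u := by
    filter_upwards [hΩ.mem_nhds hx] with y hy
    rw [(pGradient_eventuallyEq hΩ hy).self_of_nhds,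
      (pFunction_eventuallyEq hΩ hy).gradient_eq,
      gradient_half_norm_gradient_sq_sub (h.contDiffAt hΩ hy)]
  rw [laplacian_eq_traceCLM_fderiv_gradient
    ((h.contDiffOn_pFunction hN hΩ).contDiffAt (hΩ.mem_nhds hx)), hgrad.fderiv_eq]

theorem traceCLM_fderiv_pGradient (h : IsRobinTorsionSolution Ω β u) (hN : 2 ≤ N) (hΩ : IsOpen Ω)
    (hx : x ∈ Ω) : traceCLM _ (fderiv ℝ (pGradient Ω u) x) =
      traceCLM _ ((hessian Ω u x).comp (hessian Ω u x)) - N := by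
  rw [(pGradient_eventuallyEq hΩ hx).fderiv_eq, hessian_eq_fderiv_gradient hΩ hx,
    traceCLM_fderiv_gradient_half_norm_gradient_sq_sub (h.contDiffAt_three hN hΩ hx)
      (h.eventually_laplacian_eq hΩ hx)]

/-- The divergence equals `tr(H²) - N`, which involves only second derivatives and is continuous on
the compact closure. -/
theorem integrableOn_traceCLM_fderiv_pGradient (h : IsRobinTorsionSolution Ω β u) (hN : 2 ≤ N)
    (hΩ : IsOpen Ω) (hb : Bornology.IsBounded Ω) (hC2 : HasC2Boundary Ω) :
    IntegrableOn (fun x => traceCLM _ (fderiv ℝ (pGradient Ω u) x)) Ω := by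
  have hc := continuousOn_hessian hΩ hC2 h.contDiffOn
  have h1 : ContinuousOn (fun x => traceCLM _ ((hessian Ω u x).comp (hessian Ω u x)) - (N : ℝ))
      (closure Ω) :=
    ((traceCLM _).continuous.comp_continuousOn (hc.clm_comp hc)).sub continuousOn_const
  exact ((h1.integrableOn_compact hb.isCompact_closure).mono_set subset_closure).congr_fun
    (fun x hx => (h.traceCLM_fderiv_pGradient hN hΩ hx).symm) hΩ.measurableSet

end IsRobinTorsionSolution

end RobinTorsion

end

noncomputable section

/-! ### The boundary integrand. -/

namespace RobinTorsion.IsRobinTorsionSolution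

variable {N : ℕ} {Ω : Set (EuclideanSpace ℝ (Fin N))} {u : EuclideanSpace ℝ (Fin N) → ℝ}
  {x : EuclideanSpace ℝ (Fin N)} {β : ℝ}

/-- The Robin condition, differentiated along the boundary. -/
theorem inner_hessian_add_inner_gradNormal (h : IsRobinTorsionSolution Ω β u) (hΩ : IsOpen Ω)
    (hC2 : HasC2Boundary Ω) (hx : x ∈ frontier Ω) {τ : EuclideanSpace ℝ (Fin N)}
    (hτ : inner ℝ (outerNormal Ω x) τ = 0) :
    inner ℝ (grad Ω u x) (gradNormal Ω x τ) + inner ℝ (hessian Ω u x τ) (outerNormal Ω x) +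
      β * inner ℝ (grad Ω u x) τ = 0 := by
  obtain ⟨U, e, ρ, hxU, hc⟩ := hC2.exists_isGraphChart hΩ hx
  have hn := outerNormal_eq_unitGradient hc hΩ hxU hx
  have hxc : x ∈ closure Ω := frontier_subset_closure hx
  obtain ⟨γ, hγ0, hγ, hγs⟩ := hc.exists_curve hΩ hxU hx
    ((fderiv_apply_eq_zero_iff hc).2 (by rwa [← hn]))
  have h1 := (hasFDerivWithinAt_grad hΩ hC2 h.contDiffOn hxc).mono
    (frontier_subset_closure (s := Ω))
  have h2 := hasFDerivWithinAt_outerNormal hc hΩ hxU hx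
  have h3 := (h.contDiffOn.differentiableOn (by norm_num) x hxc).hasFDerivWithinAt.mono
    (frontier_subset_closure (s := Ω))
  have h4 : HasFDerivWithinAt (fun y => normalDeriv Ω u y + β * u y) _ (frontier Ω) x :=
    (h1.inner ℝ h2).add (h3.const_mul β)
  have h5 := h4.apply_eq_of_curve (hasFDerivWithinAt_const (0:ℝ) x _) hγ0 hγ hγs
    (hγs.mono fun t ht => h.robin _ ht)
  have h6 : gradNormal Ω x τ = fderiv ℝ (unitGradient ρ) x τ := by
    rw [gradNormal_apply hc hΩ hxU hx, ← hn, hτ, zero_smul, sub_zero]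
  have h7 : fderivWithin ℝ u (closure Ω) x τ = inner ℝ (grad Ω u x) τ := by
    rw [grad, inner_gradientWithin_left]
  rw [h6, ← h7]
  simpa using h5

/-- The last summand is `β` times the integrand of the surface divergence theorem for `u∇u`. The
identity thus replaces `⟨∇P, ν⟩` by the claimed integrand up to a term of integral zero. -/
theorem surface_identity (h : IsRobinTorsionSolution Ω β u) (hN : 2 ≤ N) (hΩ : IsOpen Ω)
    (hC2 : HasC2Boundary Ω) (hx : x ∈ frontier Ω) :
    inner ℝ (pGradient Ω u x) (outerNormal Ω x) =
      -inner ℝ (gradNormal Ω x (tangentialGrad Ω u x)) (tangentialGrad Ω u x) -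
        2 * β * ‖tangentialGrad Ω u x‖ ^ 2 -
        ((N : ℝ) - 1) * (normalDeriv Ω u x * (normalDeriv Ω u x * meanCurvature Ω x - 1)) +
        β * (traceCLM _ (u x • hessian Ω u x + (innerSL ℝ (grad Ω u x)).smulRight (grad Ω u x)) -
          inner ℝ ((u x • hessian Ω u x + (innerSL ℝ (grad Ω u x)).smulRight (grad Ω u x))
            (outerNormal Ω x)) (outerNormal Ω x) -
          traceCLM _ (gradNormal Ω x) * inner ℝ (u x • grad Ω u x) (outerNormal Ω x)) := by
  obtain ⟨U, e, ρ, hxU, hc⟩ := hC2.exists_isGraphChart hΩ hx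
  have hxc : x ∈ closure Ω := frontier_subset_closure hx
  have hM := meanCurvature_eq hc hΩ hxU hx hN
  have hn1 : ‖outerNormal Ω x‖ = 1 := by
    rw [outerNormal_eq_unitGradient hc hΩ hxU hx, norm_unitGradient (hc.gradient_ne_zero x)]
  have hB := inner_gradNormal_outerNormal hc hΩ hxU hx (tangentialGrad Ω u x)
  have hH := h.inner_hessian_comm hΩ hC2 hxc (tangentialGrad Ω u x) (outerNormal Ω x)
  have hR := h.robin x hx
  have htr := h.traceCLM_hessian hΩ hC2 hxc
  have hdec : grad Ω u x = tangentialGrad Ω u x + normalDeriv Ω u x • outerNormal Ω x := by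
    rw [tangentialGrad, sub_add_cancel]
  have hτ : inner ℝ (outerNormal Ω x) (tangentialGrad Ω u x) = 0 := by
    rw [tangentialGrad, inner_sub_right, real_inner_smul_right, real_inner_self_eq_norm_sq, hn1,
      real_inner_comm, normalDeriv]
    ring
  have hT := h.inner_hessian_add_inner_gradNormal hΩ hC2 hx hτ
  rw [← hM, pGradient]
  set τ := tangentialGrad Ω u x
  set n := outerNormal Ω x
  set d := normalDeriv Ω u x
  set B := gradNormal Ω x
  set H := hessian Ω u x
  rw [hdec] at hT ⊢
  rw [real_inner_comm] at hB
  simp only [inner_add_left, inner_sub_left, real_inner_smul_left,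
    map_add, map_smul, traceCLM_smulRight, innerSL_apply_apply, htr,
    _root_.add_apply, _root_.smul_apply, ContinuousLinearMap.smulRight_apply, hτ,
    real_inner_comm n τ, real_inner_self_eq_norm_sq, hn1, smul_eq_mul, hB] at hT ⊢
  rw [real_inner_comm τ (B τ)]
  -- `hT` eliminates `⟨Hτ, ν⟩`. The multiple of `hR` exchanges `βu` for `-d` in the three terms with
  -- `⟨Hν, ν⟩`, `N` and the curvature.
  linear_combination hT + (inner ℝ (H n) n - N + ((N : ℝ) - 1) * meanCurvature Ω x * d) * hR

end RobinTorsion.IsRobinTorsionSolution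

end

/-! ### The fundamental identity. -/

open RobinTorsion in
theorem mainTheorem4 {N : ℕ} (hN : 2 ≤ N) (Ω : Set (EuclideanSpace ℝ (Fin N)))
    (hΩ_open : IsOpen Ω) (hΩ_conn : IsConnected Ω) (hΩ_bdd : Bornology.IsBounded Ω)
    (hΩ_C2 : HasC2Boundary Ω) (β : ℝ) (hβ : β ≠ 0)
    (hβ_steklov : ∀ μ : ℝ, IsSteklovEigenvalue Ω μ → β ≠ -μ)
    (u : EuclideanSpace ℝ (Fin N) → ℝ) (hu : IsRobinTorsionSolution Ω β u) :
    ContDiffOn ℝ 2 (pFunction Ω u) Ω ∧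
    IntegrableOn (Δ (pFunction Ω u)) Ω volume ∧
    Integrable (fun x => inner ℝ (gradNormal Ω x (tangentialGrad Ω u x)) (tangentialGrad Ω u x))
      (surfaceMeasure Ω) ∧
    Integrable (fun x => ‖tangentialGrad Ω u x‖ ^ 2) (surfaceMeasure Ω) ∧
    Integrable (fun x => normalDeriv Ω u x * (normalDeriv Ω u x * meanCurvature Ω x - 1))
      (surfaceMeasure Ω) ∧
    ∫ x in Ω, (Δ (pFunction Ω u)) x =
      - ∫ x, inner ℝ (gradNormal Ω x (tangentialGrad Ω u x)) (tangentialGrad Ω u x)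
          ∂(surfaceMeasure Ω)
      - 2 * β * ∫ x, ‖tangentialGrad Ω u x‖ ^ 2 ∂(surfaceMeasure Ω)
      - ((N : ℝ) - 1) *
          ∫ x, normalDeriv Ω u x * (normalDeriv Ω u x * meanCurvature Ω x - 1)
            ∂(surfaceMeasure Ω) := by
  have hC := hΩ_C2.hasGraphCharts hΩ_open
  have hfin : Module.finrank ℝ (EuclideanSpace ℝ (Fin N)) = N := finrank_euclideanSpace_fin
  have hfc : frontier Ω ⊆ closure Ω := frontier_subset_closure
  have hint : ∀ {f : EuclideanSpace ℝ (Fin N) → ℝ}, ContinuousOn f (frontier Ω) →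
      Integrable f (surfaceMeasure Ω) := fun {f} hf => by
    have := hC.integrableOn_frontier hΩ_open hΩ_bdd hf
    rwa [hfin] at this
  have hν : ContinuousOn (outerNormal Ω) (frontier Ω) := hC.continuousOn_normal
  have hgrad := contDiffOn_grad hΩ_open hΩ_C2 hu.contDiffOn
  have hg : ContinuousOn (grad Ω u) (frontier Ω) := hgrad.continuousOn.mono hfc
  have hd : ContinuousOn (normalDeriv Ω u) (frontier Ω) := hg.inner (𝕜 := ℝ) hν
  have hτ : ContinuousOn (tangentialGrad Ω u) (frontier Ω) := hg.sub (hd.smul hν)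
  have hM : ContinuousOn (meanCurvature Ω) (frontier Ω) := by
    refine (hC.continuousOn_curvature.const_smul ((N : ℝ) - 1)⁻¹).congr fun x hx => ?_
    obtain ⟨U, e, ρ, hxU, hc⟩ := hΩ_C2.exists_isGraphChart hΩ_open hx
    have hN' : (N : ℝ) - 1 ≠ 0 := by
      have : (2:ℝ) ≤ N := by exact_mod_cast hN
      linarith
    rw [Pi.smul_apply, ← meanCurvature_eq hc hΩ_open hxU hx hN, smul_eq_mul, inv_mul_cancel_left₀ hN']
  have hA := hint ((hΩ_C2.continuousOn_gradNormal_apply hΩ_open hτ).inner (𝕜 := ℝ) hτ)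
  have hB : Integrable (fun x => ‖tangentialGrad Ω u x‖ ^ 2) (surfaceMeasure Ω) :=
    hint (hτ.norm.pow 2)
  have hD : Integrable (fun x => normalDeriv Ω u x * (normalDeriv Ω u x * meanCurvature Ω x - 1))
      (surfaceMeasure Ω) :=
    hint (hd.mul ((hd.mul hM).sub (continuousOn_const (c := (1:ℝ)))))
  have hV := hu.integrableOn_traceCLM_fderiv_pGradient hN hΩ_open hΩ_bdd hΩ_C2
  have hVc := hu.continuousOn_pGradient hΩ_open hΩ_C2
  have hL : EqOn (fun x => traceCLM _ (fderiv ℝ (IsRobinTorsionSolution.pGradient Ω u) x))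
      (Δ (pFunction Ω u)) Ω :=
    fun x hx => (hu.laplacian_pFunction_eq hN hΩ_open hx).symm
  refine ⟨hu.contDiffOn_pFunction hN hΩ_open, hV.congr_fun hL hΩ_open.measurableSet, hA, hB, hD, ?_⟩
  have hgauss := hC.setIntegral_divergence hΩ_open hΩ_bdd (hu.contDiffOn_pGradient hN hΩ_open)
    hVc hV
  have hdiv := hC.setIntegral_surfaceDivergence hΩ_open hΩ_bdd (w := fun x => u x • grad Ω u x)
    (Dw := fun x => u x • hessian Ω u x + (innerSL ℝ (grad Ω u x)).smulRight (grad Ω u x))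
    ((hu.contDiffOn.of_le (by norm_num)).smul hgrad |>.mono subset_closure)
    (hu.contDiffOn.continuousOn.smul hgrad.continuousOn) (fun x hx => by
      have h1 := (hu.contDiffAt hΩ_open hx).differentiableAt (by norm_num)
      have h2 := (hgrad.contDiffAt (closure_mem_nhds hΩ_open hx)).differentiableAt (by norm_num)
      rw [fderiv_fun_smul h1 h2, fderiv_grad_eq_hessian hΩ_open hx]
      congr 2
      ext v
      rw [innerSL_apply_apply, grad_eq_gradient hΩ_open hx, inner_gradient_left])
    ((hu.contDiffOn.continuousOn.smul (continuousOn_hessian hΩ_open hΩ_C2 hu.contDiffOn)).add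
      (((ContinuousLinearMap.smulRightL ℝ _ _).continuous.comp_continuousOn
        ((innerSL ℝ).continuous.comp_continuousOn hgrad.continuousOn)).clm_apply
        hgrad.continuousOn))
  rw [hfin] at hgauss hdiv
  change _ = ∫ x, _ ∂(surfaceMeasure Ω) at hgauss
  change ∫ x, _ ∂(surfaceMeasure Ω) = 0 at hdiv
  have hmeas : MeasurableSet (frontier Ω) := isClosed_frontier.measurableSet
  have hVn := hint ((hVc.mono hfc).inner (𝕜 := ℝ) hν)
  have hsum : ∀ᵐ x ∂(surfaceMeasure Ω), _ := (ae_restrict_mem hmeas).mono fun x hx =>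
    hu.surface_identity hN hΩ_open hΩ_C2 hx
  -- By `surface_identity` the integrand is `β` times the integrand of `hdiv`. No separate
  -- integrability of the latter is needed.
  have hS : ∫ x, (inner ℝ (IsRobinTorsionSolution.pGradient Ω u x) (outerNormal Ω x) +
      inner ℝ (gradNormal Ω x (tangentialGrad Ω u x)) (tangentialGrad Ω u x) +
      2 * β * ‖tangentialGrad Ω u x‖ ^ 2 + ((N : ℝ) - 1) *
        (normalDeriv Ω u x * (normalDeriv Ω u x * meanCurvature Ω x - 1))) ∂(surfaceMeasure Ω) =
      0 := by
    rw [← mul_zero β, ← hdiv, ← integral_const_mul]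
    refine integral_congr_ae (hsum.mono fun x hx => ?_)
    simp only
    rw [hx]
    ring
  rw [integral_add, integral_add, integral_add hVn hA, integral_const_mul, integral_const_mul] at hS
  · rw [← setIntegral_congr_fun hΩ_open.measurableSet hL, hgauss]
    linarith
  · exact hVn.add hA
  · exact hB.const_mul _
  · exact (hVn.add hA).add (hB.const_mul _)
  · exact hD.const_mul _
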